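/- **Setting.** Let $\Omega=[0,2\pi]^2$ with periodic boundary conditions. Let $H$ be the space of real, $2\pi$-periodic, mean-free, divergence-free $L^2$ vector fields, $|u|^2=\int_\Omega|u|^2dx$. Let $V\subset H$ be the subspace of fields with weak first derivatives in $L^2$, $\|u\|^2=\sum_{j=1,2}|\partial_ju|^2$. Let $\mathbb P$ be the Leray projection, $A=-\mathbb P\Delta$ the Stokes operator with domain $D(A)$, $B(u,v)=\mathbb P((u\cdot\nabla)v)$, and $P_N$ the projection onto the wavenumbers $|k|\le N$, for real $N>0$. Let $C_L>0$ denote any constant such that $|u|_{L^4(\Omega)}^2\le C_L\|u\||u|$ for all $u\in V$. Let $\nu>0$. Given a matrix $M=(m_{ij})\in\mathbb R^{2\times2}$, maps $F_1,F_2:V\to H$ with $F_j(0)=0$, and forces $g_1,g_2\in L^\infty(0,\infty;H)$, a (global strong) solution of the intertwined system $$\frac{dv_i}{dt}+\nu Av_i+B(v_i,v_i)=g_i+m_{i1}F_1(v_1)+m_{i2}F_2(v_2),\qquad i=1,2,$$ is a pair with $v_i\in C([0,T];V)\cap L^2(0,T;D(A))$ for all $T>0$ that satisfies the equations in $H$.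 The system is *finite-dimensionally assisted self-synchronous* if for all $g_1,g_2\in L^\infty(0,\infty;H)$ there is $N'>0$ such that, for every solution, with arbitrary initial data in $V$: $|P_{N'}(v_1(t)-v_2(t))|\to0$ and $|g_1(t)-g_2(t)|\to0$ as $t\to\infty$ imply $|v_1(t)-v_2(t)|\to0$. For real $\mu_1,\mu_2$ and $N>0$ the *symmetric nudging intertwinement* is $$\frac{dv_1}{dt}+\nu Av_1+B(v_1,v_1)=g_1-\mu_1P_Nv_1+\mu_2P_Nv_2,\qquad \frac{dv_2}{dt}+\nu Av_2+B(v_2,v_2)=g_2+\mu_2P_Nv_1-\mu_1P_Nv_2,$$ i.e. the coupling is $-MP_N(v_1,v_2)$ with $M=\begin{pmatrix}\mu_1&-\mu_2\\-\mu_2&\mu_1\end{pmatrix}$. Assume that $M$ is non-negative definite. Put $\mathfrak g_j=\sup_{t\ge0}|g_j(t)|/\nu^2$ and $\mathfrak g=(\mathfrak g_1^2+\mathfrak g_2^2)^{1/2}$ (suprema and limits in time of forces are essential ones). **Theorem.** The symmetric nudging intertwinement is finite-dimensionally assisted self-synchronous. More precisely, for all $g_1,g_2\in L^\infty(0,\infty;H)$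 and every solution $(v_1,v_2)$ with initial data in $V$, if $|P_N(v_1(t)-v_2(t))|\to0$ and $|g_1(t)-g_2(t)|\to0$ as $t\to\infty$, then $|v_1(t)-v_2(t)|\to0$ as $t\to\infty$, provided that either 1. $N\ge 4C_L\mathfrak g$, or 2. $\mu_1>\mu_2\ge0$, $\mu_1+\mu_2\le\frac14N^2\nu$, and there are $\tilde g_1,\tilde g_2\in L^\infty(0,\infty;V)$ such that $$N\ge 4C_L\Big(\frac{\nu}{\mu_1-\mu_2}\tilde{\mathfrak G}^2+\tilde{\mathfrak g}^2\Big)^{1/2},$$ where, with $\tilde G_j=g_j-(\mu_1-\mu_2)\tilde g_j$, $\tilde{\mathfrak G}=\sup_{t\ge0}\big(|\tilde G_1(t)|^2+|\tilde G_2(t)|^2\big)^{1/2}/\nu^2$, $\tilde{\mathfrak g}_j=\sup_{t\ge0}\|\tilde g_j(t)\|/\nu$ and $\tilde{\mathfrak g}^2=\tilde{\mathfrak g}_1^2+\tilde{\mathfrak g}_2^2$. -/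

import Mathlib

open Filter Topology MeasureTheory
open scoped ENNReal

noncomputable section

namespace PeriodicNSE

/-! ### Function spaces on the torus

The square `Ω = [0, 2π]²` with periodic boundary conditions is parametrised by the unit torus:
the point `y` stands for `x = 2π y`, so that `UnitAddTorus.mFourier k y = exp (i k · x)` and
`∫_Ω f dx = (2π)² ∫ f dy`, where `dy` is the probability Haar measure. -/

abbrev Torus : Type := UnitAddTorus (Fin 2)

abbrev torusMeasure : Measure Torus := Measure.pi fun _ => AddCircle.haarAddCircle

abbrev Plane : Type := EuclideanSpace ℝ (Fin 2)

/-- Square integrable real vector fields on the torus. -/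
abbrev L2 : Type := Lp Plane 2 torusMeasure

/-- The wavenumber `k ∈ ℤ²` as a vector of the plane. -/
def waveVector (k : Fin 2 → ℤ) : Plane := WithLp.toLp 2 fun i => (k i : ℝ)

/-- The `i`-th component of the Fourier coefficient
`û_k = (2π)⁻² ∫_Ω exp (- i k · x) u(x) dx`. -/
def coeff (u : L2) (k : Fin 2 → ℤ) (i : Fin 2) : ℂ :=
  ∫ y, UnitAddTorus.mFourier (-k) y * ((u y i : ℝ) : ℂ) ∂torusMeasure

/-- An `L²` field is determined by its Fourier coefficients. -/
theorem coeff_injective {u w : L2} (h : ∀ k i, coeff u k i = coeff w k i) : u = w := by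
  have key : ∀ i, (fun y => ((u y i : ℝ) : ℂ)) =ᵐ[torusMeasure] fun y => ((w y i : ℝ) : ℂ) := by
    intro i
    have hm : ∀ z : L2, MemLp (fun y => ((z y i : ℝ) : ℂ)) 2 torusMeasure := fun z =>
      ((Complex.ofRealCLM.comp (EuclideanSpace.proj (𝕜 := ℝ) i)).comp_memLp' (Lp.memLp z))
    have e : (hm u).toLp _ = (hm w).toLp _ := by
      apply (UnitAddTorus.mFourierBasis (d := Fin 2)).repr.injective
      ext k
      rw [UnitAddTorus.mFourierBasis_repr, UnitAddTorus.mFourierBasis_repr]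
      have hc : ∀ z : L2, UnitAddTorus.mFourierCoeff ((hm z).toLp _) k = coeff z k i := by
        intro z
        unfold UnitAddTorus.mFourierCoeff coeff
        apply integral_congr_ae
        filter_upwards [(hm z).coeFn_toLp] with y hy
        rw [hy, smul_eq_mul]
      rw [hc u, hc w, h]
    exact (MemLp.toLp_eq_toLp_iff _ _).1 e
  apply Lp.ext
  filter_upwards [key 0, key 1] with y h0 h1
  ext i
  fin_cases i
  · exact_mod_cast h0
  · exact_mod_cast h1

/-- Constant fields, and the gradients `k cos (k · x)` and `k sin (k · x)` of trigonometric
monomials (up to sign). -/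
def testFields : Set L2 :=
  {φ | (∃ c : Plane, φ =ᵐ[torusMeasure] fun _ => c) ∨
    (∃ k : Fin 2 → ℤ,
      φ =ᵐ[torusMeasure] fun y => (UnitAddTorus.mFourier k y).re • waveVector k) ∨
    (∃ k : Fin 2 → ℤ,
      φ =ᵐ[torusMeasure] fun y => (UnitAddTorus.mFourier k y).im • waveVector k)}

/-- The space `H` of mean-free fields that are divergence-free in the sense of distributions
(trigonometric polynomials being dense in the smooth periodic functions). -/
def H : Submodule ℝ L2 := (Submodule.span ℝ testFields)ᗮ

instance instCompleteSpaceH : CompleteSpace H := by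
  unfold H; infer_instance

/-- The Leray projection, i.e. the orthogonal projection of `L²` onto `H`. -/
def leray (f : L2) : H := H.orthogonalProjectionOnto f

/-- `f` is the image of `u` under the Fourier multiplier with symbol `m`. -/
def IsMultiplier (m : (Fin 2 → ℤ) → ℂ) (u f : H) : Prop :=
  ∀ k i, coeff f k i = m k * coeff u k i

/-- The image under a Fourier multiplier is unique. -/
theorem IsMultiplier.unique {m : (Fin 2 → ℤ) → ℂ} {u f f' : H}
    (h : IsMultiplier m u f) (h' : IsMultiplier m u f') : f = f' :=
  Subtype.ext (coeff_injective fun k i => (h k i).trans (h' k i).symm)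

open Classical in
/-- The Fourier multiplier with symbol `m` (`0` outside its domain). -/
def multiplier (m : (Fin 2 → ℤ) → ℂ) (u : H) : H :=
  if h : ∃ f, IsMultiplier m u f then h.choose else 0

def derivSymbol (j : Fin 2) (k : Fin 2 → ℤ) : ℂ := Complex.I * (k j : ℂ)

def stokesSymbol (k : Fin 2 → ℤ) : ℂ := ((‖waveVector k‖ ^ 2 : ℝ) : ℂ)

open Classical in
def lowSymbol (N : ℝ) (k : Fin 2 → ℤ) : ℂ := if ‖waveVector k‖ ≤ N then 1 else 0

/-- The weak partial derivative `∂_j` with respect to `x_j`. -/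
def pd (j : Fin 2) (u : H) : H := multiplier (derivSymbol j) u

/-- The Stokes operator `A = -ℙΔ`. -/
def stokes (u : H) : H := multiplier stokesSymbol u

/-- The projection `P_N` onto the wavenumbers `|k| ≤ N`. -/
def lowPass (N : ℝ) (u : H) : H := multiplier (lowSymbol N) u

/-- The space `V` of fields of `H` with weak first derivatives in `L²`. -/
def V : Set H := {u | ∀ j, ∃ f, IsMultiplier (derivSymbol j) u f}

/-- The domain `D(A)` of the Stokes operator. -/
def DA : Set H := {u | ∃ f, IsMultiplier stokesSymbol u f}

/-- The norm `|u| = (∫_Ω |u|² dx)^{1/2}` of `H`. -/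
def hNorm (u : H) : ℝ := 2 * Real.pi * ‖u‖

/-- The norm `‖u‖ = (∑_j |∂_j u|²)^{1/2}` of `V`. -/
def vNorm (u : H) : ℝ := Real.sqrt (∑ j, hNorm (pd j u) ^ 2)

open Classical in
/-- `B(u, v) = ℙ((u · ∇)v)`, for `(u · ∇)v` in `L²` (which holds for `u ∈ D(A)` and `v ∈ V`). -/
def bilin (u v : H) : H :=
  if h : MemLp (fun y => ∑ j, ((u : L2) y j) • ((pd j v : L2) y)) 2 torusMeasure
  then leray (h.toLp _) else 0

/-- `C` is a constant in Ladyzhenskaya's inequality `|u|_{L⁴(Ω)}² ≤ C ‖u‖ |u|` on `V`, the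
norm in `L⁴(Ω)` being `(2π)^{1/2}` times the one for the probability Haar measure. -/
def IsLadyzhenskayaConstant (C : ℝ) : Prop :=
  0 < C ∧ ∀ u ∈ V,
    ENNReal.ofReal (2 * Real.pi) * eLpNorm (u : L2) 4 torusMeasure ^ 2
      ≤ ENNReal.ofReal (C * vNorm u * hNorm u)

/-! ### Forces -/

/-- Lebesgue measure on the time axis `(0, ∞)`. -/
abbrev timeMeasure : Measure ℝ := volume.restrict (Set.Ioi 0)

/-- `g ∈ L^∞(0, ∞; H)`. -/
def IsForce (g : ℝ → H) : Prop := MemLp g ∞ timeMeasure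

/-- `g ∈ L^∞(0, ∞; V)`. -/
def IsRegularForce (g : ℝ → H) : Prop :=
  MemLp g ∞ timeMeasure ∧ (∀ᵐ t ∂timeMeasure, g t ∈ V) ∧
    ∀ j, MemLp (fun t => pd j (g t)) ∞ timeMeasure

/-- The (essential) supremum over `t ≥ 0` of a bounded nonnegative function. -/
def timeSup (a : ℝ → ℝ) : ℝ := (eLpNorm a ∞ timeMeasure).toReal

/-- `𝔤 = (𝔤₁² + 𝔤₂²)^{1/2}` with `𝔤_j = sup_t |g_j(t)| / ν²`. -/
def grashof (ν : ℝ) (g : Fin 2 → ℝ → H) : ℝ :=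
  Real.sqrt (∑ j, (timeSup (fun t => hNorm (g j t)) / ν ^ 2) ^ 2)

/-- `sup_t |G(t)| / ν²` for a pair `G = (G₁, G₂)`, where `|G|² = |G₁|² + |G₂|²`. -/
def pairGrashof (ν : ℝ) (G : Fin 2 → ℝ → H) : ℝ :=
  timeSup (fun t => Real.sqrt (∑ j, hNorm (G j t) ^ 2)) / ν ^ 2

/-- `(∑_j (sup_t ‖g_j(t)‖ / ν)²)^{1/2}`. -/
def shiftNumber (ν : ℝ) (g : Fin 2 → ℝ → H) : ℝ :=
  Real.sqrt (∑ j, (timeSup (fun t => vNorm (g j t)) / ν) ^ 2)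

/-! ### Intertwined Navier-Stokes systems -/

/-- `v = (v₁, v₂)` is a global strong solution of
`dv_j/dt + ν A v_j + B(v_j, v_j) = g_j + m_{j1} F₁(v₁) + m_{j2} F₂(v₂)`, `j = 1, 2`:
`v_j ∈ C([0, T]; V) ∩ L²(0, T; D(A))` for all `T > 0`, and the equation holds in `H` (in
integrated form, i.e. `v_j` is absolutely continuous and the equation holds for a.e. `t`). -/
structure IsIntertwinedSolution (ν : ℝ) (M : Matrix (Fin 2) (Fin 2) ℝ) (F : Fin 2 → H → H)
    (g : Fin 2 → ℝ → H) (v : Fin 2 → ℝ → H) : Prop where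
  mem_V : ∀ j, ∀ t, 0 ≤ t → v j t ∈ V
  continuous_V : ∀ j, ∀ t₀, 0 ≤ t₀ →
    Tendsto (fun t => vNorm (v j t - v j t₀)) (𝓝[Set.Ici 0] t₀) (𝓝 0)
  mem_DA : ∀ j, ∀ᵐ t ∂timeMeasure, v j t ∈ DA
  memLp_stokes : ∀ j, ∀ T : ℝ, 0 < T →
    MemLp (fun t => stokes (v j t)) 2 (volume.restrict (Set.Ioo 0 T))
  intervalIntegrable : ∀ j, ∀ t : ℝ, 0 ≤ t →
    IntervalIntegrable
      (fun s => g j s + ∑ l, M j l • F l (v l s) - ν • stokes (v j s) - bilin (v j s) (v j s))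
      volume 0 t
  equation : ∀ j, ∀ t : ℝ, 0 ≤ t →
    v j t = v j 0 + ∫ s in (0 : ℝ)..t,
      (g j s + ∑ l, M j l • F l (v l s) - ν • stokes (v j s) - bilin (v j s) (v j s))

/-- `|g₁(t) - g₂(t)| → 0` as `t → ∞` (up to null sets of times, since elements of
`L^∞(0, ∞; H)` are defined almost everywhere only). -/
def ForcesSynchronize (g : Fin 2 → ℝ → H) : Prop :=
  Tendsto (fun t => hNorm (g 0 t - g 1 t)) (atTop ⊓ ae volume) (𝓝 0)

/-- `|P_N v₁(t) - P_N v₂(t)| → 0` as `t → ∞`. -/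
def LowModesSynchronize (N : ℝ) (v : Fin 2 → ℝ → H) : Prop :=
  Tendsto (fun t => hNorm (lowPass N (v 0 t) - lowPass N (v 1 t))) atTop (𝓝 0)

/-- `|v₁(t) - v₂(t)| → 0` as `t → ∞`. -/
def Synchronizes (v : Fin 2 → ℝ → H) : Prop :=
  Tendsto (fun t => hNorm (v 0 t - v 1 t)) atTop (𝓝 0)

/-- Finite-dimensionally assisted self-synchronous intertwinement: for all forces there is a
cut-off, independent of the initial data, for which synchronization of the low modes and of the
forces implies synchronization. -/
def IsFDAssistedSelfSynchronous (ν : ℝ) (M : Matrix (Fin 2) (Fin 2) ℝ) (F : Fin 2 → H → H) :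
    Prop :=
  ∀ g : Fin 2 → ℝ → H, (∀ j, IsForce (g j)) →
    ∃ N' : ℝ, 0 < N' ∧ ∀ v : Fin 2 → ℝ → H, IsIntertwinedSolution ν M F g v →
      LowModesSynchronize N' v → ForcesSynchronize g → Synchronizes v

/-- The coupling matrix of the symmetric nudging intertwinement. -/
def nudgingMatrix (μ₁ μ₂ : ℝ) : Matrix (Fin 2) (Fin 2) ℝ := !![μ₁, -μ₂; -μ₂, μ₁]

/-- The intertwining function of the nudging intertwinement; with `nudgingMatrix μ₁ μ₂` the
coupling terms are `-μ₁ P_N v₁ + μ₂ P_N v₂` and `μ₂ P_N v₁ - μ₁ P_N v₂`. -/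
def nudgingFunction (N : ℝ) : Fin 2 → H → H := fun _ u => -lowPass N u

end PeriodicNSE

end

open PeriodicNSE

open Filter Topology MeasureTheory
open scoped ENNReal

namespace PeriodicNSE

/-! Put w = v₁ - v₂. In the energy identity for w the convection leaves only (B(w,v₁),w), and the
coupling leaves (μ₁+μ₂)|P_N w|², which is nonnegative because M ≥ 0 forces |μ₂| ≤ μ₁. If
|(B(w,v₁),w)| ≤ θ‖w‖|w|, Young's inequality spends half of the dissipation 2ν‖w‖² on this term; the
other half dominates νL²(|w|² - |P_L w|²), and the low modes tend to zero by assumption. This gives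
d/dt |w|² ≤ -(νL² - η - θ²/ν)|w|² + o(1) (`difference_rate_le`). Grönwall's inequality
(`IsPrimitiveOf.tendsto_zero`) yields decay once ∫ θ² over [s,t] is at most κ(t-s) + K with κ < ν²L²
and K independent of s and t: this is `synchronizes_of_integral_le`.

The three claims differ in θ and in the source of its mean. Under condition 1, θ = C_L‖v₁‖ and the
energy inequality bounds the mean of ‖v₁‖². Under condition 2, θ is the same and the enstrophy
inequality bounds the mean: the coupling damps the low modes at rate μ₁-μ₂, viscosity does so for
the high modes, and the part (μ₁-μ₂)g̃ of the force is paired with v in V. The factor 4 in both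
conditions is slack. For the existence of N' no Ladyzhenskaya constant is at hand; there (B(w,v₁),w)
= -(B(w,w),v₁) and the embedding of D(A) into the bounded fields allow θ = c|Av₁|, whose mean square
the enstrophy inequality bounds by the forces alone.

Enstrophy estimates rest on the two-dimensional cancellation (B(v,v),Av) = 0 (`inner_bilin_stokes`).
This and (B(u,v),v) = 0 are proved in Fourier variables: fields in D(A) have absolutely summable
coefficients, so the trilinear form is an absolutely convergent sum over triads k+l+m = 0
(`hasSum_trilinearTerm`), and summing over permutations of the triad cancels it. The norm `‖u‖`
belongs to the probability measure, whence the powers of 2π. -/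

open UnitAddTorus in
/-- The Fourier coefficients of a scalar function on the torus. -/
noncomputable def scoeff (f : Torus → ℂ) (k : Fin 2 → ℤ) : ℂ :=
  ∫ y, mFourier (-k) y * f y ∂torusMeasure

/-! ### Fourier series of scalar functions and of triple products. -/

section Scalar

open UnitAddTorus
open scoped ComplexConjugate

theorem norm_mFourier_apply (k : Fin 2 → ℤ) (y : Torus) : ‖mFourier k y‖ = 1 := by
  simp only [mFourier, ContinuousMap.coe_mk, norm_prod, fourier_apply, Circle.norm_coe,
    Finset.prod_const_one]

theorem mFourierCoeff_toLp_eq_scoeff {f : Torus → ℂ} (hf : MemLp f 2 torusMeasure)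
    (k : Fin 2 → ℤ) : mFourierCoeff (hf.toLp f) k = scoeff f k := by
  unfold mFourierCoeff scoeff
  apply integral_congr_ae
  filter_upwards [hf.coeFn_toLp] with y hy
  rw [hy, smul_eq_mul]

theorem hasSum_conj_scoeff_mul {f g : Torus → ℂ} (hf : MemLp f 2 torusMeasure)
    (hg : MemLp g 2 torusMeasure) :
    HasSum (fun k => conj (scoeff f k) * scoeff g k) (∫ y, conj (f y) * g y ∂torusMeasure) := by
  have h := hasSum_prod_mFourierCoeff (d := Fin 2) (hf.toLp f) (hg.toLp g)
  have e : (∫ y, conj (f y) * g y ∂torusMeasure)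
      = ∫ y, conj (hf.toLp f y) * hg.toLp g y ∂torusMeasure := by
    apply integral_congr_ae
    filter_upwards [hf.coeFn_toLp, hg.coeFn_toLp] with y h1 h2
    rw [h1, h2]
  rw [e]
  simp only [mFourierCoeff_toLp_eq_scoeff] at h
  exact h

theorem summable_sq_scoeff {f : Torus → ℂ} (hf : MemLp f 2 torusMeasure) :
    Summable fun k => ‖scoeff f k‖ ^ 2 := by
  have h := (hasSum_sq_mFourierCoeff (d := Fin 2) (hf.toLp f)).summable
  convert h using 2 with k
  rw [mFourierCoeff_toLp_eq_scoeff]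

theorem exists_scoeff_eq {a : (Fin 2 → ℤ) → ℂ} (ha : Summable fun k => ‖a k‖ ^ 2) :
    ∃ f : Torus → ℂ, MemLp f 2 torusMeasure ∧ ∀ k, scoeff f k = a k := by
  have hm : Memℓp a 2 := by
    apply memℓp_gen
    simpa using ha
  let F := (mFourierBasis (d := Fin 2)).repr.symm ⟨a, hm⟩
  have hF : MemLp (F : Torus → ℂ) 2 torusMeasure := Lp.memLp F
  refine ⟨F, hF, fun k => ?_⟩
  rw [← mFourierCoeff_toLp_eq_scoeff hF]
  have : hF.toLp F = F := Lp.toLp_coeFn F hF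
  rw [this, ← mFourierBasis_repr]
  simp [F]

theorem ae_eq_of_scoeff_eq {f g : Torus → ℂ} (hf : MemLp f 2 torusMeasure)
    (hg : MemLp g 2 torusMeasure) (h : ∀ k, scoeff f k = scoeff g k) :
    f =ᵐ[torusMeasure] g := by
  have e : hf.toLp f = hg.toLp g := by
    apply (mFourierBasis (d := Fin 2)).repr.injective
    ext k
    rw [mFourierBasis_repr, mFourierBasis_repr, mFourierCoeff_toLp_eq_scoeff,
      mFourierCoeff_toLp_eq_scoeff, h]
  exact (MemLp.toLp_eq_toLp_iff _ _).1 e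

theorem integral_mFourier_mul (k l : Fin 2 → ℤ) :
    ∫ y, mFourier (-k) y * mFourier l y ∂torusMeasure = if k = l then 1 else 0 := by
  have h := (orthonormal_iff_ite.1 (orthonormal_mFourier (d := Fin 2))) k l
  rw [ContinuousMap.inner_toLp] at h
  rw [← h]
  apply integral_congr_ae
  refine Eventually.of_forall fun y => ?_
  simp only [mFourier_neg]
  ring

theorem memLp_continuousMap (f : C(Torus, ℂ)) (p : ℝ≥0∞) : MemLp f p torusMeasure :=
  MemLp.of_bound f.continuous.aestronglyMeasurable ‖f‖
    (Eventually.of_forall f.norm_coe_le_norm)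

theorem scoeff_mFourier (k l : Fin 2 → ℤ) : scoeff (mFourier l) k = if k = l then 1 else 0 :=
  integral_mFourier_mul k l

/-- The series converges uniformly to a continuous function with the same Fourier coefficients, and
coefficients determine a square integrable function. -/
theorem ae_eq_tsum_of_summable {f : Torus → ℂ} (hf : MemLp f 2 torusMeasure)
    (h : Summable fun k => ‖scoeff f k‖) :
    f =ᵐ[torusMeasure] fun y => ∑' k, scoeff f k * mFourier k y := by
  have hs : Summable fun k => scoeff f k • (mFourier k : C(Torus, ℂ)) := by
    refine .of_norm ?_
    simpa only [norm_smul, mFourier_norm, mul_one] using h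
  have h1 := hs.hasSum
  set F : C(Torus, ℂ) := ∑' k, scoeff f k • (mFourier k : C(Torus, ℂ)) with hF
  have h2 : ∀ k, scoeff F k = scoeff f k := by
    intro k
    have h3 := (ContinuousMap.toLp (E := ℂ) 2 torusMeasure ℂ).hasSum h1
    have h4 := ((innerSL ℂ (ContinuousMap.toLp (E := ℂ) 2 torusMeasure ℂ (mFourier k)))).hasSum h3
    have h5 : ∀ G : C(Torus, ℂ), innerSL ℂ (ContinuousMap.toLp (E := ℂ) 2 torusMeasure ℂ
        (mFourier k)) (ContinuousMap.toLp (E := ℂ) 2 torusMeasure ℂ G) = scoeff G k := by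
      intro G
      rw [innerSL_apply_apply, ContinuousMap.inner_toLp]
      apply integral_congr_ae
      refine Eventually.of_forall fun y => ?_
      simp only [mFourier_neg]
      ring
    rw [← h5 F]
    refine h4.unique ?_
    have h6 : ∀ l, innerSL ℂ (ContinuousMap.toLp (E := ℂ) 2 torusMeasure ℂ (mFourier k))
        (ContinuousMap.toLp (E := ℂ) 2 torusMeasure ℂ (scoeff f l • mFourier l))
        = if l = k then scoeff f k else 0 := by
      intro l
      rw [map_smul, map_smul, h5, scoeff_mFourier]
      by_cases hkl : k = l
      · subst hkl; simp
      · rw [if_neg hkl, if_neg (Ne.symm hkl)]; simp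
    simp only [h6]
    exact hasSum_ite_eq k _
  have h7 := ae_eq_of_scoeff_eq (memLp_continuousMap F 2) hf h2
  filter_upwards [h7] with y hy
  rw [← hy]
  have := (ContinuousMap.evalCLM ℂ y).hasSum h1
  exact this.tsum_eq.symm

theorem scoeff_conj (f : Torus → ℂ) (k : Fin 2 → ℤ) :
    scoeff (fun y => conj (f y)) k = conj (scoeff f (-k)) := by
  unfold scoeff
  rw [← integral_conj]
  congr 1
  ext y
  rw [map_mul, ← mFourier_neg, neg_neg]

theorem mul_mul_le_add_sq {a b c : ℝ} (ha : 0 ≤ a) : a * b * c ≤ a * b ^ 2 + a * c ^ 2 := by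
  nlinarith [mul_nonneg ha (sq_nonneg (b - c)), mul_nonneg ha (sq_nonneg (b + c))]

/-- The involution `(k, l) ↦ (k, -k - l)`. -/
def tripleFlip (ι : Type*) [AddCommGroup ι] : ι × ι ≃ ι × ι where
  toFun p := (p.1, -p.1 - p.2)
  invFun p := (p.1, -p.1 - p.2)
  left_inv p := by ext <;> simp
  right_inv p := by ext <;> simp

theorem tripleFlip_apply {ι : Type*} [AddCommGroup ι] (p : ι × ι) :
    tripleFlip ι p = (p.1, -p.1 - p.2) := rfl

/-- Young's inequality ℓ¹ * ℓ² ⊂ ℓ² in trilinear form: abc ≤ ab² + ac², and each of the two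
majorants is a product series after relabelling the triad. -/
theorem summable_convolution {ι : Type*} [AddCommGroup ι] {a b c : ι → ℝ} (ha : Summable a)
    (hb : Summable fun k => b k ^ 2) (hc : Summable fun k => c k ^ 2) (ha0 : ∀ k, 0 ≤ a k)
    (hb0 : ∀ k, 0 ≤ b k) (hc0 : ∀ k, 0 ≤ c k) :
    Summable fun p : ι × ι => a p.1 * b p.2 * c (-p.1 - p.2) := by
  have h1 : Summable fun p : ι × ι => a p.1 * b p.2 ^ 2 :=
    Summable.mul_of_nonneg (g := fun k => b k ^ 2) ha hb ha0 fun k => sq_nonneg (b k)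
  have h2 : Summable fun p : ι × ι => a p.1 * c p.2 ^ 2 :=
    Summable.mul_of_nonneg (g := fun k => c k ^ 2) ha hc ha0 fun k => sq_nonneg (c k)
  have h3 : Summable fun p : ι × ι => a p.1 * c (-p.1 - p.2) ^ 2 := by
    have h := h2.comp_injective (tripleFlip ι).injective
    simpa only [Function.comp_def, tripleFlip_apply] using h
  have h4 : ∀ p : ι × ι, 0 ≤ a p.1 * b p.2 * c (-p.1 - p.2) := fun p =>
    mul_nonneg (mul_nonneg (ha0 _) (hb0 _)) (hc0 _)
  have h5 : ∀ p : ι × ι, a p.1 * b p.2 * c (-p.1 - p.2)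
      ≤ a p.1 * b p.2 ^ 2 + a p.1 * c (-p.1 - p.2) ^ 2 := fun p => mul_mul_le_add_sq (ha0 p.1)
  exact Summable.of_nonneg_of_le h4 h5 (h1.add h3)

theorem summable_scoeff_triple {f g h : Torus → ℂ} (hf : Summable fun k => ‖scoeff f k‖)
    (hg : MemLp g 2 torusMeasure) (hh : MemLp h 2 torusMeasure) :
    Summable fun p : (Fin 2 → ℤ) × (Fin 2 → ℤ) =>
      scoeff f p.1 * scoeff g p.2 * scoeff h (-p.1 - p.2) := by
  refine .of_norm ?_
  have h1 := summable_convolution hf (summable_sq_scoeff hg) (summable_sq_scoeff hh)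
    (fun _ => norm_nonneg _) (fun _ => norm_nonneg _) (fun _ => norm_nonneg _)
  refine h1.congr fun p => ?_
  rw [norm_mul, norm_mul]

/-- Expand f in its uniformly convergent series and integrate term by term; the k-th term is
Parseval's identity for g and the conjugate of exp(ik·x) h. Absolute summability over pairs turns
the iterated sum into a sum over triads, which may then be permuted. -/
theorem hasSum_scoeff_triple {f g h : Torus → ℂ} (hf2 : MemLp f 2 torusMeasure)
    (hf : Summable fun k => ‖scoeff f k‖) (hg : MemLp g 2 torusMeasure)
    (hh : MemLp h 2 torusMeasure) :
    HasSum (fun p : (Fin 2 → ℤ) × (Fin 2 → ℤ) =>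
      scoeff f p.1 * scoeff g p.2 * scoeff h (-p.1 - p.2))
      (∫ y, f y * g y * h y ∂torusMeasure) := by
  have hs := summable_scoeff_triple hf hg hh
  have hgh : Integrable (fun y => g y * h y) torusMeasure := hg.integrable_mul hh
  have hfib : ∀ k, HasSum (fun l => scoeff f k * scoeff g l * scoeff h (-k - l))
      (scoeff f k * ∫ y, mFourier k y * (g y * h y) ∂torusMeasure) := by
    intro k
    have hm : MemLp (fun y => conj (mFourier k y * h y)) 2 torusMeasure := by
      refine hh.of_le ?_ ?_
      · exact Complex.continuous_conj.comp_aestronglyMeasurable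
          ((mFourier k).continuous.aestronglyMeasurable.mul hh.1)
      · refine Eventually.of_forall fun y => ?_
        simp [norm_mFourier_apply]
    have h1 := (hasSum_conj_scoeff_mul hm hg).mul_left (scoeff f k)
    have e1 : (∫ y, conj (conj (mFourier k y * h y)) * g y ∂torusMeasure)
        = ∫ y, mFourier k y * (g y * h y) ∂torusMeasure := by
      congr 1; ext y; rw [Complex.conj_conj]; ring
    rw [e1] at h1
    refine h1.congr_fun fun l => ?_
    rw [scoeff_conj, Complex.conj_conj]
    have : scoeff (fun y => mFourier k y * h y) (-l) = scoeff h (-k - l) := by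
      unfold scoeff
      congr 1; ext y
      rw [show -(-k - l) = - -l + k by abel, mFourier_add]; ring
    rw [this]; ring
  have h2 := hs.hasSum.prod_fiberwise hfib
  have h3 := hasSum_integral_of_summable_integral_norm (μ := torusMeasure)
    (F := fun k y => scoeff f k * (mFourier k y * (g y * h y))) ?_ ?_
  · have e : (∫ y, f y * g y * h y ∂torusMeasure)
        = ∑' p : (Fin 2 → ℤ) × (Fin 2 → ℤ),
          scoeff f p.1 * scoeff g p.2 * scoeff h (-p.1 - p.2) := by
      rw [← h2.tsum_eq]
      simp only [integral_const_mul] at h3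
      rw [h3.tsum_eq]
      apply integral_congr_ae
      filter_upwards [ae_eq_tsum_of_summable hf2 hf] with y hy
      rw [mul_assoc, hy, ← tsum_mul_right]
      congr 1; ext k; ring
    rw [e]; exact hs.hasSum
  · intro k
    refine (hgh.bdd_mul (c := 1) (mFourier k).continuous.aestronglyMeasurable
      (Eventually.of_forall fun y => (norm_mFourier_apply k y).le)).const_mul _
  · simp only [norm_mul, norm_mFourier_apply, one_mul]
    simp only [integral_const_mul]
    exact hf.mul_right _

end Scalar

/-! ### Fourier coefficients and Parseval's identity for real vector fields. -/

section Fields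

open UnitAddTorus
open scoped ComplexConjugate

/-- The `i`-th component of a real field, as a complex valued function. -/
noncomputable def comp (u : L2) (i : Fin 2) (y : Torus) : ℂ := ((u y i : ℝ) : ℂ)

theorem memLp_component (u : L2) (i : Fin 2) : MemLp (fun y => u y i) 2 torusMeasure :=
  (EuclideanSpace.proj (𝕜 := ℝ) i).comp_memLp' (Lp.memLp u)

theorem memLp_comp (u : L2) (i : Fin 2) : MemLp (comp u i) 2 torusMeasure :=
  (Complex.ofRealCLM.comp (EuclideanSpace.proj (𝕜 := ℝ) i)).comp_memLp' (Lp.memLp u)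

theorem coeff_eq_scoeff (u : L2) (k : Fin 2 → ℤ) (i : Fin 2) :
    coeff u k i = scoeff (comp u i) k := rfl

theorem conj_coeff (u : L2) (k : Fin 2 → ℤ) (i : Fin 2) :
    conj (coeff u k i) = coeff u (-k) i := by
  rw [coeff_eq_scoeff, coeff_eq_scoeff, ← neg_neg k, ← scoeff_conj, neg_neg]
  congr 1; ext y; simp [comp]

theorem integrable_mFourier_mul {f : Torus → ℂ} (hf : Integrable f torusMeasure)
    (k : Fin 2 → ℤ) : Integrable (fun y => mFourier k y * f y) torusMeasure :=
  hf.bdd_mul (c := 1) (mFourier k).continuous.aestronglyMeasurable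
    (Eventually.of_forall fun y => (norm_mFourier_apply k y).le)

theorem coeff_add (u v : L2) (k : Fin 2 → ℤ) (i : Fin 2) :
    coeff (u + v) k i = coeff u k i + coeff v k i := by
  unfold coeff
  rw [← integral_add]
  · apply integral_congr_ae
    filter_upwards [Lp.coeFn_add u v] with y hy
    rw [hy]; simp; ring
  · exact integrable_mFourier_mul ((memLp_comp u i).integrable one_le_two) _
  · exact integrable_mFourier_mul ((memLp_comp v i).integrable one_le_two) _

theorem coeff_smul (r : ℝ) (u : L2) (k : Fin 2 → ℤ) (i : Fin 2) :
    coeff (r • u) k i = r * coeff u k i := by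
  unfold coeff
  rw [← integral_const_mul]
  apply integral_congr_ae
  filter_upwards [Lp.coeFn_smul r u] with y hy
  rw [hy]; simp; ring

/-- The contribution of the mode `k` to the inner product of two fields. -/
noncomputable def modeInner (u v : L2) (k : Fin 2 → ℤ) : ℝ :=
  ∑ i, inner ℝ (coeff u k i) (coeff v k i)

theorem inner_eq_integral (u v : L2) :
    inner ℝ u v = ∫ y, ∑ i, u y i * v y i ∂torusMeasure := by
  rw [L2.inner_def]
  simp [PiLp.inner_apply, mul_comm]

theorem hasSum_modeInner (u v : L2) : HasSum (modeInner u v) (inner ℝ u v) := by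
  have h : ∀ i, HasSum (fun k => inner ℝ (coeff u k i) (coeff v k i))
      (∫ y, u y i * v y i ∂torusMeasure) := by
    intro i
    have h1 := Complex.reCLM.hasSum (hasSum_conj_scoeff_mul (memLp_comp u i) (memLp_comp v i))
    have e : Complex.reCLM (∫ y, conj (comp u i y) * comp v i y ∂torusMeasure)
        = ∫ y, u y i * v y i ∂torusMeasure := by
      rw [← Complex.reCLM.integral_comp_comm]
      · simp [comp]
      · exact (Complex.conjCLE.toContinuousLinearMap.comp_memLp'
          (memLp_comp u i)).integrable_mul (memLp_comp v i)
    rw [e] at h1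
    refine h1.congr_fun fun k => ?_
    simp [coeff_eq_scoeff, Complex.inner, mul_comm]
  rw [inner_eq_integral, integral_finsetSum]
  · exact hasSum_sum fun i _ => h i
  · exact fun i _ => (memLp_component u i).integrable_mul (memLp_component v i)

theorem modeInner_self (u : L2) (k : Fin 2 → ℤ) :
    modeInner u u k = ∑ i, ‖coeff u k i‖ ^ 2 := by
  simp [modeInner]

theorem hasSum_sq_coeff (u : L2) :
    HasSum (fun k => ∑ i, ‖coeff u k i‖ ^ 2) (‖u‖ ^ 2) := by
  have h := hasSum_modeInner u u
  rw [real_inner_self_eq_norm_sq] at h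
  exact h.congr_fun fun k => (modeInner_self u k).symm

theorem norm_coeff_le (u : L2) (k : Fin 2 → ℤ) (i : Fin 2) : ‖coeff u k i‖ ≤ ‖u‖ := by
  have h := hasSum_sq_coeff u
  have h1 : ∑ i, ‖coeff u k i‖ ^ 2 ≤ ‖u‖ ^ 2 :=
    le_hasSum h k fun l _ => Finset.sum_nonneg fun i _ => sq_nonneg _
  have h2 : ‖coeff u k i‖ ^ 2 ≤ ∑ i, ‖coeff u k i‖ ^ 2 :=
    Finset.single_le_sum (f := fun i => ‖coeff u k i‖ ^ 2) (fun _ _ => sq_nonneg _)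
      (Finset.mem_univ i)
  exact (sq_le_sq₀ (norm_nonneg _) (norm_nonneg _)).1 (h2.trans h1)

/-- The Fourier coefficient as a continuous linear functional. -/
noncomputable def coeffCLM (k : Fin 2 → ℤ) (i : Fin 2) : L2 →L[ℝ] ℂ :=
  LinearMap.mkContinuous
    { toFun := fun u => coeff u k i
      map_add' := fun u v => coeff_add u v k i
      map_smul' := fun r u => by simp [coeff_smul] } 1
    fun u => by simpa using norm_coeff_le u k i

theorem coeff_sub (u v : L2) (k : Fin 2 → ℤ) (i : Fin 2) :
    coeff (u - v) k i = coeff u k i - coeff v k i := map_sub (coeffCLM k i) u v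

/-- Riesz–Fischer in each component; the Hermitian symmetry `hc` makes the resulting function equal
to its conjugate, hence real. -/
theorem exists_coeff_eq {a : (Fin 2 → ℤ) → Fin 2 → ℂ}
    (ha : Summable fun k => ∑ i, ‖a k i‖ ^ 2) (hc : ∀ k i, conj (a k i) = a (-k) i) :
    ∃ u : L2, ∀ k i, coeff u k i = a k i := by
  have hai : ∀ i, Summable fun k => ‖a k i‖ ^ 2 := fun i =>
    Summable.of_nonneg_of_le (fun k => sq_nonneg _) (fun k =>
      Finset.single_le_sum (f := fun i => ‖a k i‖ ^ 2) (fun _ _ => sq_nonneg _)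
        (Finset.mem_univ i)) ha
  choose f hf hfa using fun i => exists_scoeff_eq (hai i)
  have hreal : ∀ i, f i =ᵐ[torusMeasure] fun y => conj (f i y) := by
    intro i
    refine ae_eq_of_scoeff_eq (hf i)
      (Complex.conjCLE.toContinuousLinearMap.comp_memLp' (hf i)) fun k => ?_
    rw [scoeff_conj, hfa, hfa, hc, neg_neg]
  have hm : MemLp (fun y => (WithLp.toLp 2 fun i => (f i y).re : Plane)) 2 torusMeasure := by
    rw [memLp_piLp_iff]
    exact fun i => Complex.reCLM.comp_memLp' (hf i)
  refine ⟨hm.toLp _, fun k i => ?_⟩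
  rw [← hfa]
  unfold coeff scoeff
  apply integral_congr_ae
  filter_upwards [hm.coeFn_toLp, hreal i] with y hy hr
  rw [hy]
  simp only
  rw [Complex.conj_eq_iff_re.1 hr.symm]

end Fields

/-! ### Solenoidal fields, Fourier multipliers and spectral inequalities. -/

section Solenoidal

open UnitAddTorus
open scoped ComplexConjugate

theorem inner_of_ae_eq_smul {φ : L2} {r : Torus → ℝ} {c : Plane}
    (hφ : φ =ᵐ[torusMeasure] fun y => r y • c) (u : L2) :
    inner ℝ φ u = ∫ y, r y * ∑ i, c i * u y i ∂torusMeasure := by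
  rw [inner_eq_integral]
  apply integral_congr_ae
  filter_upwards [hφ] with y hy
  rw [hy, Finset.mul_sum]
  exact Finset.sum_congr rfl fun i _ => by simp; ring

theorem coeff_zero (u : L2) (i : Fin 2) :
    coeff u 0 i = ((∫ y, u y i ∂torusMeasure : ℝ) : ℂ) := by
  unfold coeff
  rw [← integral_complex_ofReal]
  simp [mFourier_zero]

theorem integrable_dot (c : Plane) (u : L2) :
    Integrable (fun y => ∑ i, c i * u y i) torusMeasure :=
  integrable_finsetSum _ fun i _ => ((memLp_component u i).integrable one_le_two).const_mul _

theorem sum_mul_coeff (c : Plane) (u : L2) (k : Fin 2 → ℤ) :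
    ∑ i, (c i : ℂ) * coeff u k i
      = ∫ y, mFourier (-k) y * ((∑ i, c i * u y i : ℝ) : ℂ) ∂torusMeasure := by
  unfold coeff
  simp_rw [← integral_const_mul]
  rw [← integral_finsetSum]
  · congr 1; ext y
    push_cast
    rw [Finset.mul_sum]
    exact Finset.sum_congr rfl fun i _ => by ring
  · exact fun i _ =>
      (integrable_mFourier_mul ((memLp_comp u i).integrable one_le_two) _).const_mul _

theorem re_sum_mul_coeff (c : Plane) (u : L2) (k : Fin 2 → ℤ) :
    (∑ i, (c i : ℂ) * coeff u k i).re
      = ∫ y, (mFourier k y).re * ∑ i, c i * u y i ∂torusMeasure := by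
  rw [sum_mul_coeff, ← Complex.reCLM_apply, ← Complex.reCLM.integral_comp_comm]
  · congr 1; ext y
    rw [Complex.reCLM_apply, Complex.re_mul_ofReal, mFourier_neg, Complex.conj_re]
  · exact integrable_mFourier_mul (integrable_dot c u).ofReal _

theorem im_sum_mul_coeff (c : Plane) (u : L2) (k : Fin 2 → ℤ) :
    (∑ i, (c i : ℂ) * coeff u k i).im
      = -∫ y, (mFourier k y).im * ∑ i, c i * u y i ∂torusMeasure := by
  rw [sum_mul_coeff, ← Complex.imCLM_apply, ← Complex.imCLM.integral_comp_comm, ← integral_neg]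
  · congr 1; ext y
    rw [Complex.imCLM_apply, Complex.im_mul_ofReal, mFourier_neg, Complex.conj_im, neg_mul]
  · exact integrable_mFourier_mul (integrable_dot c u).ofReal _

theorem exists_ae_eq_smul {r : Torus → ℝ} (hr : Continuous r) (c : Plane) :
    ∃ φ : L2, φ =ᵐ[torusMeasure] fun y => r y • c := by
  have hm : MemLp (fun y => r y • c) 2 torusMeasure := by
    have hc : Continuous fun y => r y • c := hr.smul continuous_const
    exact MemLp.of_bound hc.aestronglyMeasurable
      ‖(⟨fun y => r y • c, hc⟩ : C(Torus, Plane))‖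
      (Eventually.of_forall
        (ContinuousMap.norm_coe_le_norm (⟨fun y => r y • c, hc⟩ : C(Torus, Plane))))
  exact ⟨hm.toLp _, hm.coeFn_toLp⟩

/-- The real and imaginary parts of k·û_k are, up to sign, the pairings of u with k cos(k·x) and k
sin(k·x); constants test the mean. -/
theorem mem_H_iff (u : L2) :
    u ∈ H ↔ (∀ i, coeff u 0 i = 0) ∧ ∀ k, ∑ i, (k i : ℂ) * coeff u k i = 0 := by
  have hH : u ∈ H ↔ ∀ φ ∈ testFields, inner ℝ φ u = 0 := by
    unfold H
    rw [Submodule.mem_orthogonal]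
    refine ⟨fun h φ hφ => h φ (Submodule.subset_span hφ), fun h φ hφ => ?_⟩
    induction hφ using Submodule.span_induction with
    | mem x hx => exact h x hx
    | zero => simp
    | add x y _ _ hx hy => rw [inner_add_left, hx, hy, add_zero]
    | smul a x _ hx => rw [real_inner_smul_left, hx, mul_zero]
  have hw : ∀ k : Fin 2 → ℤ, ∑ i, (k i : ℂ) * coeff u k i
      = ∑ i, ((waveVector k i : ℝ) : ℂ) * coeff u k i := fun k => by simp [waveVector]
  rw [hH]
  constructor
  · intro h
    refine ⟨fun i => ?_, fun k => ?_⟩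
    · obtain ⟨φ, hφ⟩ := exists_ae_eq_smul (continuous_const (y := (1 : ℝ)))
        (EuclideanSpace.single i (1 : ℝ))
      have h1 := h φ (Or.inl ⟨_, by simpa using hφ⟩)
      rw [inner_of_ae_eq_smul hφ] at h1
      rw [coeff_zero]
      norm_cast
      simpa using h1
    · rw [hw]
      obtain ⟨φ, hφ⟩ := exists_ae_eq_smul
        (Complex.continuous_re.comp (mFourier k).continuous) (waveVector k)
      obtain ⟨ψ, hψ⟩ := exists_ae_eq_smul
        (Complex.continuous_im.comp (mFourier k).continuous) (waveVector k)
      have h1 := h φ (Or.inr (Or.inl ⟨k, hφ⟩))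
      have h2 := h ψ (Or.inr (Or.inr ⟨k, hψ⟩))
      rw [inner_of_ae_eq_smul hφ] at h1
      rw [inner_of_ae_eq_smul hψ] at h2
      apply Complex.ext
      · rw [re_sum_mul_coeff]; exact h1
      · rw [im_sum_mul_coeff, Complex.zero_im, neg_eq_zero]; exact h2
  · rintro ⟨h0, hk⟩ φ (⟨c, hφ⟩ | ⟨k, hφ⟩ | ⟨k, hφ⟩)
    · have hφ' : φ =ᵐ[torusMeasure] fun y => (1 : ℝ) • c := by simpa using hφ
      rw [inner_of_ae_eq_smul hφ']
      simp only [one_mul]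
      rw [integral_finsetSum _ fun i _ =>
        ((memLp_component u i).integrable one_le_two).const_mul _]
      refine Finset.sum_eq_zero fun i _ => ?_
      have h1 := h0 i
      rw [coeff_zero] at h1
      rw [integral_const_mul, Complex.ofReal_eq_zero.1 h1, mul_zero]
    · rw [inner_of_ae_eq_smul hφ, ← re_sum_mul_coeff, ← hw, hk, Complex.zero_re]
    · rw [inner_of_ae_eq_smul hφ, ← neg_eq_zero, ← im_sum_mul_coeff, ← hw, hk, Complex.zero_im]

theorem coeff_zero_mode (u : H) (i : Fin 2) : coeff u 0 i = 0 := ((mem_H_iff u).1 u.2).1 i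

theorem sum_mul_coeff_eq_zero (u : H) (k : Fin 2 → ℤ) : ∑ i, (k i : ℂ) * coeff u k i = 0 :=
  ((mem_H_iff u).1 u.2).2 k

/-- A scalar symbol preserves k·û_k = 0 and the vanishing mean, so only reality and square
summability have to be supplied. -/
theorem exists_isMultiplier {m : (Fin 2 → ℤ) → ℂ} (hm : ∀ k, conj (m k) = m (-k)) {u : H}
    (hs : Summable fun k => ∑ i, ‖m k * coeff u k i‖ ^ 2) : ∃ f, IsMultiplier m u f := by
  obtain ⟨f, hf⟩ := exists_coeff_eq hs fun k i => by rw [map_mul, hm, conj_coeff]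
  refine ⟨⟨f, (mem_H_iff f).2 ⟨fun i => ?_, fun k => ?_⟩⟩, hf⟩
  · rw [hf, coeff_zero_mode, mul_zero]
  · simp_rw [hf]
    rw [← mul_zero (m k), ← sum_mul_coeff_eq_zero u k, Finset.mul_sum]
    exact Finset.sum_congr rfl fun i _ => by ring

theorem multiplier_spec {m : (Fin 2 → ℤ) → ℂ} {u : H} (h : ∃ f, IsMultiplier m u f) :
    IsMultiplier m u (multiplier m u) := by
  unfold multiplier
  rw [dif_pos h]
  exact h.choose_spec

theorem IsMultiplier.eq {m : (Fin 2 → ℤ) → ℂ} {u f : H} (h : IsMultiplier m u f) :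
    multiplier m u = f := (multiplier_spec ⟨f, h⟩).unique h

theorem IsMultiplier.sub {m : (Fin 2 → ℤ) → ℂ} {u v f g : H} (h : IsMultiplier m u f)
    (h' : IsMultiplier m v g) : IsMultiplier m (u - v) (f - g) := fun k i => by
  push_cast
  rw [coeff_sub, coeff_sub, h, h', mul_sub]

theorem multiplier_sub {m : (Fin 2 → ℤ) → ℂ} {u v : H} (h : ∃ f, IsMultiplier m u f)
    (h' : ∃ f, IsMultiplier m v f) :
    multiplier m (u - v) = multiplier m u - multiplier m v :=
  ((multiplier_spec h).sub (multiplier_spec h')).eq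

theorem sq_norm_waveVector (k : Fin 2 → ℤ) : ‖waveVector k‖ ^ 2 = ∑ j, (k j : ℝ) ^ 2 := by
  simp [waveVector, EuclideanSpace.norm_sq_eq]

theorem waveVector_neg (k : Fin 2 → ℤ) : ‖waveVector (-k)‖ = ‖waveVector k‖ := by
  rw [← sq_eq_sq₀ (norm_nonneg _) (norm_nonneg _), sq_norm_waveVector, sq_norm_waveVector]
  simp

theorem one_le_sq_norm_waveVector {k : Fin 2 → ℤ} (hk : k ≠ 0) : 1 ≤ ‖waveVector k‖ ^ 2 := by
  rw [sq_norm_waveVector]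
  have h : (1 : ℤ) ≤ ∑ j, k j ^ 2 := by
    obtain ⟨j, hj⟩ := Function.ne_iff.1 hk
    have h1 : 0 < k j ^ 2 := sq_pos_of_ne_zero hj
    have h2 : k j ^ 2 ≤ ∑ j, k j ^ 2 :=
      Finset.single_le_sum (f := fun j => k j ^ 2) (fun _ _ => sq_nonneg _) (Finset.mem_univ j)
    omega
  exact_mod_cast h

theorem sq_norm_waveVector_le (k : Fin 2 → ℤ) :
    ‖waveVector k‖ ^ 2 ≤ (‖waveVector k‖ ^ 2) ^ 2 := by
  by_cases hk : k = 0
  · subst hk; rw [sq_norm_waveVector]; simp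
  · nlinarith [one_le_sq_norm_waveVector hk]

theorem exists_lowPass (N : ℝ) (u : H) : ∃ f, IsMultiplier (lowSymbol N) u f := by
  apply exists_isMultiplier
  · intro k
    unfold lowSymbol
    rw [waveVector_neg]
    split_ifs <;> simp
  · refine Summable.of_nonneg_of_le (fun k => Finset.sum_nonneg fun i _ => sq_nonneg _)
      (fun k => Finset.sum_le_sum fun i _ => ?_) (hasSum_sq_coeff (u : L2)).summable
    unfold lowSymbol
    split_ifs
    · rw [one_mul]
    · simp

theorem coeff_lowPass (N : ℝ) (u : H) (k : Fin 2 → ℤ) (i : Fin 2) :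
    coeff (lowPass N u) k i = lowSymbol N k * coeff u k i :=
  multiplier_spec (exists_lowPass N u) k i

theorem lowPass_sub (N : ℝ) (u v : H) : lowPass N (u - v) = lowPass N u - lowPass N v :=
  multiplier_sub (exists_lowPass N u) (exists_lowPass N v)

theorem coeff_pd {u : H} (hu : u ∈ V) (j : Fin 2) (k : Fin 2 → ℤ) (i : Fin 2) :
    coeff (pd j u) k i = derivSymbol j k * coeff u k i :=
  multiplier_spec (hu j) k i

theorem coeff_stokes {u : H} (hu : u ∈ DA) (k : Fin 2 → ℤ) (i : Fin 2) :
    coeff (stokes u) k i = stokesSymbol k * coeff u k i :=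
  multiplier_spec hu k i

theorem pd_sub {u v : H} (hu : u ∈ V) (hv : v ∈ V) (j : Fin 2) :
    pd j (u - v) = pd j u - pd j v := multiplier_sub (hu j) (hv j)

theorem stokes_sub {u v : H} (hu : u ∈ DA) (hv : v ∈ DA) :
    stokes (u - v) = stokes u - stokes v := multiplier_sub hu hv

theorem sub_mem_DA {u v : H} (hu : u ∈ DA) (hv : v ∈ DA) : u - v ∈ DA :=
  ⟨_, (multiplier_spec hu).sub (multiplier_spec hv)⟩

theorem conj_derivSymbol (j : Fin 2) (k : Fin 2 → ℤ) :
    conj (derivSymbol j k) = derivSymbol j (-k) := by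
  simp [derivSymbol]

theorem norm_derivSymbol (j : Fin 2) (k : Fin 2 → ℤ) : ‖derivSymbol j k‖ ^ 2 = (k j : ℝ) ^ 2 := by
  simp [derivSymbol]

theorem sq_apply_le (k : Fin 2 → ℤ) (j : Fin 2) : (k j : ℝ) ^ 2 ≤ ‖waveVector k‖ ^ 2 := by
  rw [sq_norm_waveVector]
  exact Finset.single_le_sum (f := fun j => (k j : ℝ) ^ 2) (fun _ _ => sq_nonneg _)
    (Finset.mem_univ j)

theorem DA_subset_V : DA ⊆ V := by
  intro u hu j
  apply exists_isMultiplier (conj_derivSymbol j)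
  refine Summable.of_nonneg_of_le (fun k => Finset.sum_nonneg fun i _ => sq_nonneg _)
    (fun k => Finset.sum_le_sum fun i _ => ?_) (hasSum_sq_coeff (stokes u : L2)).summable
  rw [coeff_stokes hu, norm_mul, norm_mul, mul_pow, mul_pow, norm_derivSymbol]
  refine mul_le_mul_of_nonneg_right ?_ (sq_nonneg _)
  refine (sq_apply_le k j).trans ((sq_norm_waveVector_le k).trans (le_of_eq ?_))
  simp [stokesSymbol]

theorem lowPass_mem_V (N : ℝ) {u : H} (hu : u ∈ V) : lowPass N u ∈ V := by
  intro j
  apply exists_isMultiplier (conj_derivSymbol j)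
  refine Summable.of_nonneg_of_le (fun k => Finset.sum_nonneg fun i _ => sq_nonneg _)
    (fun k => Finset.sum_le_sum fun i _ => ?_) (hasSum_sq_coeff (pd j u : L2)).summable
  rw [coeff_pd hu, coeff_lowPass]
  unfold lowSymbol
  split_ifs
  · rw [one_mul]
  · rw [zero_mul, mul_zero, norm_zero, zero_pow two_ne_zero]
    exact sq_nonneg _

theorem modeInner_zero_mode (u v : H) : modeInner u v 0 = 0 := by
  simp [modeInner, coeff_zero_mode]

theorem modeInner_self_nonneg (u : L2) (k : Fin 2 → ℤ) : 0 ≤ modeInner u u k := by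
  rw [modeInner_self]; exact Finset.sum_nonneg fun i _ => sq_nonneg _

theorem modeInner_pd {u v : H} (hu : u ∈ V) (hv : v ∈ V) (j : Fin 2) (k : Fin 2 → ℤ) :
    modeInner (pd j u) (pd j v) k = (k j : ℝ) ^ 2 * modeInner u v k := by
  unfold modeInner
  rw [Finset.mul_sum]
  refine Finset.sum_congr rfl fun i _ => ?_
  rw [coeff_pd hu, coeff_pd hv, Complex.inner, Complex.inner]
  simp [derivSymbol]
  ring

theorem modeInner_stokes_left {u : H} (hu : u ∈ DA) (v : L2) (k : Fin 2 → ℤ) :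
    modeInner (stokes u) v k = ‖waveVector k‖ ^ 2 * modeInner u v k := by
  unfold modeInner
  rw [Finset.mul_sum]
  refine Finset.sum_congr rfl fun i _ => ?_
  rw [coeff_stokes hu, stokesSymbol, ← Complex.real_smul, real_inner_smul_left]

theorem modeInner_comm (u v : L2) (k : Fin 2 → ℤ) : modeInner u v k = modeInner v u k :=
  Finset.sum_congr rfl fun _ _ => real_inner_comm _ _

open Classical in
theorem modeInner_lowPass_left (N : ℝ) (u : H) (v : L2) (k : Fin 2 → ℤ) :
    modeInner (lowPass N u) v k = if ‖waveVector k‖ ≤ N then modeInner u v k else 0 := by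
  unfold modeInner
  simp_rw [coeff_lowPass, lowSymbol]
  split_ifs <;> simp

/-- The square of the gradient norm, for the normalised measure. -/
noncomputable def gradSq (u : H) : ℝ := ∑ j, ‖pd j u‖ ^ 2

theorem gradSq_nonneg (u : H) : 0 ≤ gradSq u := Finset.sum_nonneg fun _ _ => sq_nonneg _

theorem hasSum_grad_inner {u v : H} (hu : u ∈ V) (hv : v ∈ V) :
    HasSum (fun k => ‖waveVector k‖ ^ 2 * modeInner u v k)
      (∑ j, inner ℝ (pd j u) (pd j v)) := by
  have h := hasSum_sum (s := Finset.univ) fun j (_ : j ∈ Finset.univ) =>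
    hasSum_modeInner (pd j u : L2) (pd j v : L2)
  refine h.congr_fun fun k => ?_
  simp_rw [modeInner_pd hu hv]
  rw [← Finset.sum_mul, sq_norm_waveVector]

theorem hasSum_gradSq {u : H} (hu : u ∈ V) :
    HasSum (fun k => ‖waveVector k‖ ^ 2 * modeInner u u k) (gradSq u) := by
  have h := hasSum_grad_inner hu hu
  simp only [real_inner_self_eq_norm_sq] at h
  exact h

theorem hasSum_normSq (u : H) : HasSum (fun k => modeInner u u k) (‖u‖ ^ 2) := by
  have h := hasSum_modeInner (u : L2) (u : L2)
  rwa [real_inner_self_eq_norm_sq] at h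

theorem hasSum_stokes_normSq {u : H} (hu : u ∈ DA) :
    HasSum (fun k => (‖waveVector k‖ ^ 2) ^ 2 * modeInner u u k) (‖stokes u‖ ^ 2) := by
  refine (hasSum_normSq (stokes u)).congr_fun fun k => ?_
  rw [modeInner_stokes_left hu, modeInner_comm (u : L2) (stokes u : L2),
    modeInner_stokes_left hu]; ring

theorem inner_stokes_left {u v : H} (hu : u ∈ DA) (hv : v ∈ V) :
    inner ℝ (stokes u) v = ∑ j, inner ℝ (pd j u) (pd j v) := by
  have h := hasSum_modeInner (stokes u : L2) (v : L2)
  refine h.unique ((hasSum_grad_inner (DA_subset_V hu) hv).congr_fun fun k => ?_)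
  rw [modeInner_stokes_left hu]

theorem inner_stokes_self {u : H} (hu : u ∈ DA) : inner ℝ (stokes u) u = gradSq u := by
  rw [inner_stokes_left hu (DA_subset_V hu)]
  simp only [real_inner_self_eq_norm_sq]; rfl

theorem normSq_le_gradSq {u : H} (hu : u ∈ V) : ‖u‖ ^ 2 ≤ gradSq u := by
  refine hasSum_le (fun k => ?_) (hasSum_normSq u) (hasSum_gradSq hu)
  by_cases hk : k = 0
  · subst hk; simp [modeInner_zero_mode]
  · nlinarith [one_le_sq_norm_waveVector hk, modeInner_self_nonneg u k]

theorem gradSq_le_stokes {u : H} (hu : u ∈ DA) : gradSq u ≤ ‖stokes u‖ ^ 2 := by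
  refine hasSum_le (fun k => ?_) (hasSum_gradSq (DA_subset_V hu)) (hasSum_stokes_normSq hu)
  exact mul_le_mul_of_nonneg_right (sq_norm_waveVector_le k) (modeInner_self_nonneg _ k)

theorem inner_lowPass_left (N : ℝ) (u v : H) :
    inner ℝ (lowPass N u) v = inner ℝ (lowPass N u) (lowPass N v) := by
  have h := hasSum_modeInner (lowPass N u : L2) (v : L2)
  refine h.unique ((hasSum_modeInner (lowPass N u : L2) (lowPass N v : L2)).congr_fun
    fun k => ?_)
  rw [modeInner_lowPass_left, modeInner_lowPass_left, modeInner_comm _ (lowPass N v : L2),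
    modeInner_lowPass_left, modeInner_comm]
  split_ifs <;> rfl

theorem hasSum_lowPass_normSq (N : ℝ) (u : H) :
    HasSum (fun k => modeInner (lowPass N u) u k) (‖lowPass N u‖ ^ 2) := by
  have h := hasSum_modeInner (lowPass N u : L2) (u : L2)
  have e : inner ℝ (lowPass N u) u = ‖lowPass N u‖ ^ 2 := by
    rw [inner_lowPass_left, real_inner_self_eq_norm_sq]
  rw [← e]; exact h

theorem norm_lowPass_le (N : ℝ) (u : H) : ‖lowPass N u‖ ≤ ‖u‖ := by
  have h : ‖lowPass N u‖ ^ 2 ≤ ‖u‖ ^ 2 := by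
    refine hasSum_le (fun k => ?_) (hasSum_lowPass_normSq N u) (hasSum_normSq u)
    rw [modeInner_lowPass_left]
    split_ifs
    · exact le_rfl
    · exact modeInner_self_nonneg _ k
  exact (sq_le_sq₀ (norm_nonneg _) (norm_nonneg _)).1 h

theorem inner_lowPass_stokes (N : ℝ) {u v : H} (hu : u ∈ V) (hv : v ∈ DA) :
    inner ℝ (lowPass N u) (stokes v)
      = ∑ j, inner ℝ (pd j (lowPass N u)) (pd j (lowPass N v)) := by
  have h := hasSum_modeInner (lowPass N u : L2) (stokes v : L2)
  have hv' := DA_subset_V hv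
  refine h.unique ((hasSum_grad_inner (lowPass_mem_V N hu) (lowPass_mem_V N hv')).congr_fun
    fun k => ?_)
  rw [modeInner_comm _ (stokes v : L2), modeInner_stokes_left hv, modeInner_comm (v : L2),
    modeInner_lowPass_left, modeInner_lowPass_left, modeInner_comm _ (lowPass N v : L2),
    modeInner_lowPass_left, modeInner_comm (v : L2)]
  split_ifs <;> rfl

/-- Modes with |k| ≤ N cancel on the left; on the others N² ≤ |k|². -/
theorem spectral_gap {N : ℝ} (hN : 0 ≤ N) {u : H} (hu : u ∈ V) :
    N ^ 2 * (‖u‖ ^ 2 - ‖lowPass N u‖ ^ 2) ≤ gradSq u := by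
  refine hasSum_le (fun k => ?_)
    (((hasSum_normSq u).sub (hasSum_lowPass_normSq N u)).mul_left (N ^ 2)) (hasSum_gradSq hu)
  rw [modeInner_lowPass_left]
  have h0 := modeInner_self_nonneg u k
  split_ifs with h
  · rw [sub_self, mul_zero]; positivity
  · rw [sub_zero]
    gcongr
    exact (not_le.1 h).le

theorem spectral_gap_stokes {N : ℝ} (hN : 0 ≤ N) {u : H} (hu : u ∈ DA) :
    N ^ 2 * (gradSq u - gradSq (lowPass N u)) ≤ ‖stokes u‖ ^ 2 := by
  have hv := DA_subset_V hu
  refine hasSum_le (fun k => ?_)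
    (((hasSum_gradSq hv).sub (hasSum_gradSq (lowPass_mem_V N hv))).mul_left (N ^ 2))
    (hasSum_stokes_normSq hu)
  rw [modeInner_lowPass_left, modeInner_comm _ (lowPass N u : L2), modeInner_lowPass_left]
  have h0 := modeInner_self_nonneg u k
  split_ifs with h
  · rw [sub_self, mul_zero]; positivity
  · rw [mul_zero, sub_zero, sq (‖waveVector k‖ ^ 2), mul_assoc]
    gcongr
    exact (not_le.1 h).le

end Solenoidal

/-! ### The convective term: bounds and cancellations. -/

section Convection

open UnitAddTorus
open scoped ComplexConjugate

/-- For k ≠ 0 the coefficient of u is at most |k|⁻² times that of Au. Young's inequality splits the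
product into a summable weight and a Parseval term; the weights ‖Au‖ and ‖Au‖⁻¹ make the sum over k
linear in ‖Au‖. -/
theorem norm_coeff_le_of_mem_DA {u : H} (hu : u ∈ DA) (k : Fin 2 → ℤ) (i : Fin 2) :
    ‖coeff u k i‖ ≤ ‖stokes u‖ * ‖k‖ ^ (-4 : ℝ)
      + ‖stokes u‖⁻¹ * ∑ i, ‖coeff (stokes u) k i‖ ^ 2 := by
  have hS : ‖coeff (stokes u) k i‖ ^ 2 ≤ ∑ i, ‖coeff (stokes u) k i‖ ^ 2 :=
    Finset.single_le_sum (f := fun i => ‖coeff (stokes u) k i‖ ^ 2) (fun _ _ => sq_nonneg _)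
      (Finset.mem_univ i)
  by_cases hk : k = 0
  · subst hk
    rw [coeff_zero_mode, norm_zero]
    positivity
  have hk0 : 0 < ‖k‖ := norm_pos_iff.2 hk
  have hle : ‖k‖ ^ 2 ≤ ‖waveVector k‖ ^ 2 := by
    refine (sq_le_sq₀ (norm_nonneg _) (norm_nonneg _)).2 ?_
    refine (pi_norm_le_iff_of_nonneg (norm_nonneg _)).2 fun j => ?_
    refine abs_le_of_sq_le_sq' ?_ (norm_nonneg _) |> abs_le.2 |> fun h => by
      simpa [Int.norm_eq_abs] using h
    exact sq_apply_le k j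
  have hA : ‖k‖ ^ 2 * ‖coeff u k i‖ ≤ ‖coeff (stokes u) k i‖ := by
    rw [coeff_stokes hu, norm_mul]
    refine mul_le_mul_of_nonneg_right (hle.trans (le_of_eq ?_)) (norm_nonneg _)
    simp [stokesSymbol]
  have hpow : ‖k‖ ^ (-4 : ℝ) = (‖k‖ ^ 2)⁻¹ ^ 2 := by
    rw [Real.rpow_neg hk0.le, inv_pow, ← pow_mul]
    norm_num
  rw [hpow]
  have hx : ‖coeff u k i‖ ≤ (‖k‖ ^ 2)⁻¹ * ‖coeff (stokes u) k i‖ := by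
    rw [inv_mul_eq_div, le_div_iff₀ (by positivity)]
    linarith
  set a := (‖k‖ ^ 2)⁻¹ with ha
  set b := ‖coeff (stokes u) k i‖ with hb
  have hb0 : 0 ≤ b := norm_nonneg _
  -- If ‖Au‖ = 0, its inverse is 0 by convention, but then all coefficients of Au vanish as well.
  rcases eq_or_lt_of_le (norm_nonneg (stokes u)) with h0 | h0
  · have : b = 0 := le_antisymm ((norm_coeff_le _ k i).trans (le_of_eq h0.symm)) hb0
    rw [this, mul_zero] at hx
    exact hx.trans (by positivity)
  · set s := ‖stokes u‖ with hs
    have h1 : a * b ≤ s * a ^ 2 + s⁻¹ * b ^ 2 := by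
      have h2 : s * a ^ 2 + s⁻¹ * b ^ 2 - a * b
          = s⁻¹ * ((s * a - b / 2) ^ 2 + 3 / 4 * b ^ 2) := by
        field_simp; ring
      have h3 : 0 ≤ s⁻¹ * ((s * a - b / 2) ^ 2 + 3 / 4 * b ^ 2) := by positivity
      linarith
    have h4 : s⁻¹ * b ^ 2 ≤ s⁻¹ * ∑ i, ‖coeff (stokes u) k i‖ ^ 2 :=
      mul_le_mul_of_nonneg_left hS (by positivity)
    linarith

/-- A constant in the embedding of `D(A)` into the bounded fields. -/
noncomputable def supConst : ℝ := 2 * (∑' k : Fin 2 → ℤ, ‖k‖ ^ (-4 : ℝ) + 1)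

theorem supConst_pos : 0 < supConst := by
  have : 0 ≤ ∑' k : Fin 2 → ℤ, ‖k‖ ^ (-4 : ℝ) := tsum_nonneg fun k => by positivity
  unfold supConst; linarith

theorem hasSum_norm_coeff_bound (u : H) :
    HasSum (fun k : Fin 2 → ℤ => ‖stokes u‖ * ‖k‖ ^ (-4 : ℝ)
      + ‖stokes u‖⁻¹ * ∑ i, ‖coeff (stokes u) k i‖ ^ 2)
      (‖stokes u‖ * (∑' k : Fin 2 → ℤ, ‖k‖ ^ (-4 : ℝ) + 1)) := by
  have h1 := (EisensteinSeries.summable_one_div_norm_rpow (k := 4) (by norm_num)).hasSum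
  have h2 := (h1.mul_left ‖stokes u‖).add
    ((hasSum_sq_coeff (stokes u : L2)).mul_left ‖stokes u‖⁻¹)
  have e : ‖stokes u‖⁻¹ * ‖(stokes u : L2)‖ ^ 2 = ‖stokes u‖ := by
    change ‖stokes u‖⁻¹ * ‖stokes u‖ ^ 2 = ‖stokes u‖
    rcases eq_or_ne ‖stokes u‖ 0 with h0 | h0
    · simp [h0]
    · field_simp
  rw [e] at h2
  rw [mul_add, mul_one]
  exact h2

theorem summable_norm_coeff {u : H} (hu : u ∈ DA) (i : Fin 2) :
    Summable fun k => ‖coeff u k i‖ :=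
  Summable.of_nonneg_of_le (fun _ => norm_nonneg _) (fun k => norm_coeff_le_of_mem_DA hu k i)
    (hasSum_norm_coeff_bound u).summable

theorem ae_norm_le {u : H} (hu : u ∈ DA) :
    ∀ᵐ y ∂torusMeasure, ‖(u : L2) y‖ ≤ supConst * ‖stokes u‖ := by
  have key : ∀ i, ∀ᵐ y ∂torusMeasure, |(u : L2) y i|
      ≤ ‖stokes u‖ * (∑' k : Fin 2 → ℤ, ‖k‖ ^ (-4 : ℝ) + 1) := by
    intro i
    have hs := summable_norm_coeff hu i
    filter_upwards [ae_eq_tsum_of_summable (memLp_comp u i) hs] with y hy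
    have h1 : |(u : L2) y i| = ‖comp u i y‖ := by simp [comp]
    rw [h1, hy]
    refine (norm_tsum_le_tsum_norm ?_).trans ?_
    · simp only [norm_mul, norm_mFourier_apply, mul_one]
      exact hs
    · simp only [norm_mul, norm_mFourier_apply, mul_one]
      exact hasSum_le (fun k => norm_coeff_le_of_mem_DA hu k i) hs.hasSum
        (hasSum_norm_coeff_bound u)
  filter_upwards [key 0, key 1] with y h0 h1
  have h2 : ‖(u : L2) y‖ ≤ |(u : L2) y 0| + |(u : L2) y 1| := by
    rw [EuclideanSpace.norm_eq, Real.sqrt_le_left (by positivity)]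
    simp only [Fin.sum_univ_two, Real.norm_eq_abs]
    nlinarith [abs_nonneg ((u : L2) y 0), abs_nonneg ((u : L2) y 1)]
  unfold supConst
  linarith

/-- The field `(u · ∇)v`. -/
noncomputable def convection (u v : H) (y : Torus) : Plane :=
  ∑ j, ((u : L2) y j) • ((pd j v : L2) y)

/-- The pointwise length of the gradient. -/
noncomputable def gradNorm (v : H) (y : Torus) : ℝ := Real.sqrt (∑ j, ‖(pd j v : L2) y‖ ^ 2)

theorem memLp_gradNorm (v : H) : MemLp (gradNorm v) 2 torusMeasure := by
  have h : MemLp (fun y => (WithLp.toLp 2 fun j => (pd j v : L2) y :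
      PiLp 2 fun _ : Fin 2 => Plane)) 2 torusMeasure := by
    rw [memLp_piLp_iff]
    exact fun j => Lp.memLp _
  refine h.norm.ae_eq (Eventually.of_forall fun y => ?_)
  simp [gradNorm, PiLp.norm_eq_of_L2]

theorem integral_sq_norm (u : L2) : ∫ y, ‖u y‖ ^ 2 ∂torusMeasure = ‖u‖ ^ 2 := by
  rw [← real_inner_self_eq_norm_sq, L2.inner_def]
  simp

theorem integrable_sq_norm (u : L2) : Integrable (fun y => ‖u y‖ ^ 2) torusMeasure :=
  (Lp.memLp u).integrable_norm_pow two_ne_zero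

theorem integral_sq_gradNorm (v : H) : ∫ y, gradNorm v y ^ 2 ∂torusMeasure = gradSq v := by
  unfold gradNorm gradSq
  simp_rw [Real.sq_sqrt (Finset.sum_nonneg fun _ _ => sq_nonneg _)]
  rw [integral_finsetSum _ fun j _ => integrable_sq_norm _]
  exact Finset.sum_congr rfl fun j _ => integral_sq_norm _

theorem abs_inner_sum_le (a : Plane) (b : Fin 2 → Plane) (c : Plane) :
    |inner ℝ (∑ j, a j • b j) c| ≤ ‖a‖ * Real.sqrt (∑ j, ‖b j‖ ^ 2) * ‖c‖ := by
  refine (abs_real_inner_le_norm _ _).trans (mul_le_mul_of_nonneg_right ?_ (norm_nonneg _))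
  refine (norm_sum_le _ _).trans ?_
  simp_rw [norm_smul]
  rw [EuclideanSpace.norm_eq]
  exact Real.sum_mul_le_sqrt_mul_sqrt _ _ _

theorem norm_convection_le (u v : H) (y : Torus) :
    ‖convection u v y‖ ≤ ‖(u : L2) y‖ * gradNorm v y := by
  unfold convection gradNorm
  refine (norm_sum_le _ _).trans ?_
  simp_rw [norm_smul]
  rw [EuclideanSpace.norm_eq]
  exact Real.sum_mul_le_sqrt_mul_sqrt _ _ _

theorem gradNorm_nonneg (v : H) (y : Torus) : 0 ≤ gradNorm v y := Real.sqrt_nonneg _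

/-- A field in D(A) is bounded, so (u·∇)v is as integrable as ∇v. Hence `bilin u v` is given by its
first branch. -/
theorem memLp_convection {u : H} (hu : u ∈ DA) (v : H) :
    MemLp (convection u v) 2 torusMeasure := by
  refine (memLp_gradNorm v).of_le_mul (c := supConst * ‖stokes u‖) ?_ ?_
  · unfold convection
    exact Finset.aestronglyMeasurable_fun_sum _ fun j _ =>
      (memLp_component u j).1.smul (Lp.memLp (pd j v : L2)).1
  · filter_upwards [ae_norm_le hu] with y hy
    refine (norm_convection_le u v y).trans ?_
    rw [Real.norm_of_nonneg (gradNorm_nonneg v y)]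
    exact mul_le_mul_of_nonneg_right hy (gradNorm_nonneg v y)

theorem inner_bilin {u : H} (hu : u ∈ DA) (v w : H) :
    inner ℝ (bilin u v) w = ∫ y, inner ℝ (convection u v y) ((w : L2) y) ∂torusMeasure := by
  have h := memLp_convection hu v
  have e : bilin u v = leray (h.toLp _) := by
    unfold bilin
    exact dif_pos h
  rw [e, leray, Submodule.inner_orthogonalProjectionOnto_eq_of_mem_right, L2.inner_def]
  apply integral_congr_ae
  filter_upwards [h.coeFn_toLp] with y hy
  rw [hy]

theorem integrable_norm_mul_gradNorm_mul {u : H} (hu : u ∈ DA) (v w : H) :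
    Integrable (fun y => ‖(u : L2) y‖ * gradNorm v y * ‖(w : L2) y‖) torusMeasure := by
  have h := (memLp_gradNorm v).integrable_mul (Lp.memLp (w : L2)).norm
  refine (h.bdd_mul (c := supConst * ‖stokes u‖) (Lp.memLp (u : L2)).1.norm ?_).congr ?_
  · filter_upwards [ae_norm_le hu] with y hy
    simpa using hy
  · exact Eventually.of_forall fun y => by simp [mul_assoc]

theorem abs_inner_bilin_le {u : H} (hu : u ∈ DA) (v w : H) :
    |inner ℝ (bilin u v) w|
      ≤ ∫ y, ‖(u : L2) y‖ * gradNorm v y * ‖(w : L2) y‖ ∂torusMeasure := by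
  rw [inner_bilin hu, ← Real.norm_eq_abs]
  refine norm_integral_le_of_norm_le (integrable_norm_mul_gradNorm_mul hu v w)
    (Eventually.of_forall fun y => ?_)
  exact abs_inner_sum_le _ _ _

theorem integral_mul_le_sqrt_mul_sqrt {f g : Torus → ℝ} (hf0 : ∀ y, 0 ≤ f y)
    (hg0 : ∀ y, 0 ≤ g y) (hf : MemLp f 2 torusMeasure) (hg : MemLp g 2 torusMeasure) :
    ∫ y, f y * g y ∂torusMeasure
      ≤ Real.sqrt (∫ y, f y ^ 2 ∂torusMeasure) * Real.sqrt (∫ y, g y ^ 2 ∂torusMeasure) := by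
  have h := integral_mul_le_Lp_mul_Lq_of_nonneg (p := 2) (q := 2) (μ := torusMeasure)
    Real.HolderConjugate.two_two (Eventually.of_forall hf0) (Eventually.of_forall hg0)
    (by simpa using hf) (by simpa using hg)
  simpa only [Real.sqrt_eq_rpow, Real.rpow_two] using h

theorem integral_gradNorm_mul_norm_le (v w : H) :
    ∫ y, gradNorm v y * ‖(w : L2) y‖ ∂torusMeasure ≤ Real.sqrt (gradSq v) * ‖w‖ := by
  have h := integral_mul_le_sqrt_mul_sqrt (gradNorm_nonneg v) (fun y => norm_nonneg _)
    (memLp_gradNorm v) (Lp.memLp (w : L2)).norm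
  rw [integral_sq_gradNorm, integral_sq_norm, Real.sqrt_sq (norm_nonneg _)] at h
  exact h

theorem abs_inner_bilin_le_left {u : H} (hu : u ∈ DA) (v w : H) :
    |inner ℝ (bilin u v) w| ≤ supConst * ‖stokes u‖ * (Real.sqrt (gradSq v) * ‖w‖) := by
  refine (abs_inner_bilin_le hu v w).trans ?_
  refine le_trans ?_ (mul_le_mul_of_nonneg_left (integral_gradNorm_mul_norm_le v w)
    (mul_nonneg supConst_pos.le (norm_nonneg _)))
  rw [← integral_const_mul]
  refine integral_mono_ae (integrable_norm_mul_gradNorm_mul hu v w)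
    (((memLp_gradNorm v).integrable_mul (Lp.memLp (w : L2)).norm).const_mul _) ?_
  filter_upwards [ae_norm_le hu] with y hy
  rw [mul_assoc]
  exact mul_le_mul_of_nonneg_right hy (mul_nonneg (gradNorm_nonneg v y) (norm_nonneg _))

/-- Here the sup bound is spent on the last factor, leaving u only in L². -/
theorem abs_inner_bilin_le_right {u v w : H} (hu : u ∈ DA) (hw : w ∈ DA) :
    |inner ℝ (bilin u v) w| ≤ supConst * ‖stokes w‖ * (Real.sqrt (gradSq v) * ‖u‖) := by
  refine (abs_inner_bilin_le hu v w).trans ?_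
  refine le_trans ?_ (mul_le_mul_of_nonneg_left (integral_gradNorm_mul_norm_le v u)
    (mul_nonneg supConst_pos.le (norm_nonneg _)))
  rw [← integral_const_mul]
  refine integral_mono_ae (integrable_norm_mul_gradNorm_mul hu v w)
    (((memLp_gradNorm v).integrable_mul (Lp.memLp (u : L2)).norm).const_mul _) ?_
  filter_upwards [ae_norm_le hw] with y hy
  have h := mul_le_mul_of_nonneg_right hy (mul_nonneg (gradNorm_nonneg v y)
    (norm_nonneg ((u : L2) y)))
  exact (le_of_eq (by ring)).trans h

/-- Test the trilinear bound with w = B(u,v). -/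
theorem norm_bilin_le {u : H} (hu : u ∈ DA) (v : H) :
    ‖bilin u v‖ ≤ supConst * ‖stokes u‖ * Real.sqrt (gradSq v) := by
  have h := abs_inner_bilin_le_left hu v (bilin u v)
  rw [real_inner_self_eq_norm_sq, abs_of_nonneg (sq_nonneg _)] at h
  rcases eq_or_lt_of_le (norm_nonneg (bilin u v)) with h0 | h0
  · rw [← h0]
    exact mul_nonneg (mul_nonneg supConst_pos.le (norm_nonneg _)) (Real.sqrt_nonneg _)
  · refine le_of_mul_le_mul_right ?_ h0
    linarith

theorem hNorm_eq (u : H) : hNorm u = 2 * Real.pi * ‖u‖ := rfl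

theorem vNorm_eq (u : H) : vNorm u = 2 * Real.pi * Real.sqrt (gradSq u) := by
  unfold vNorm gradSq
  simp_rw [hNorm_eq, mul_pow]
  rw [← Finset.mul_sum, Real.sqrt_mul (by positivity), ← mul_pow,
    Real.sqrt_sq (by positivity)]

/-- Hölder's inequality with exponents 4, 2, 4, then Ladyzhenskaya's inequality for the two factors
w. -/
theorem abs_inner_bilin_le_ladyzhenskaya {C : ℝ} (hC : IsLadyzhenskayaConstant C) {w : H}
    (hw : w ∈ DA) (v : H) :
    |inner ℝ (bilin w v) w| ≤ C * vNorm v * (Real.sqrt (gradSq w) * ‖w‖) := by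
  have hL := hC.2 w (DA_subset_V hw)
  have hpi := Real.pi_pos
  have hm4 : MemLp (w : L2) 4 torusMeasure :=
    MemLp.of_bound (Lp.memLp (w : L2)).1 _ (ae_norm_le hw)
  have hm : MemLp (fun y => ‖(w : L2) y‖ ^ 2) 2 torusMeasure := by
    have := hm4.norm_rpow_div 2
    convert this using 2
    · simp
    · rw [ENNReal.div_eq_inv_mul, show (4 : ℝ≥0∞) = 2 * 2 by norm_num, ← mul_assoc,
        ENNReal.inv_mul_cancel (by norm_num) (by norm_num), one_mul]
  have h1 : |inner ℝ (bilin w v) w| ≤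
      Real.sqrt (∫ y, (‖(w : L2) y‖ ^ 2) ^ 2 ∂torusMeasure) * Real.sqrt (gradSq v) := by
    have h := integral_mul_le_sqrt_mul_sqrt (fun y => sq_nonneg ‖(w : L2) y‖) (gradNorm_nonneg v)
      hm (memLp_gradNorm v)
    rw [integral_sq_gradNorm] at h
    refine (abs_inner_bilin_le hw v w).trans (le_trans (le_of_eq ?_) h)
    congr 1; ext y; ring
  -- In normalised norms the hypothesis has 2π on the left and (2π)² on the right; the surplus 2π is
  -- the factor that turns the normalised gradient norm of v into `vNorm v`.
  have h2 : Real.sqrt (∫ y, (‖(w : L2) y‖ ^ 2) ^ 2 ∂torusMeasure)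
      ≤ 2 * Real.pi * C * (Real.sqrt (gradSq w) * ‖w‖) := by
    rw [hm4.eLpNorm_eq_integral_rpow_norm (by norm_num) (by norm_num),
      ← ENNReal.ofReal_pow (by positivity), ← ENNReal.ofReal_mul (by positivity),
      ENNReal.ofReal_le_ofReal_iff (by
        rw [vNorm_eq, hNorm_eq]; have := hC.1.le; positivity), vNorm_eq, hNorm_eq] at hL
    have e : ((∫ y, ‖(w : L2) y‖ ^ (4 : ℝ≥0∞).toReal ∂torusMeasure) ^ ((4 : ℝ≥0∞).toReal)⁻¹) ^ 2
        = Real.sqrt (∫ y, (‖(w : L2) y‖ ^ 2) ^ 2 ∂torusMeasure) := by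
      rw [Real.sqrt_eq_rpow, ← Real.rpow_natCast, ← Real.rpow_mul
        (integral_nonneg fun y => by positivity)]
      congr 1
      · congr 1; ext y
        rw [← pow_mul]
        exact_mod_cast Real.rpow_natCast ‖(w : L2) y‖ 4
      · norm_num
    rw [e] at hL
    have h3 : 0 < 2 * Real.pi := by positivity
    refine le_of_mul_le_mul_left (hL.trans (le_of_eq ?_)) h3
    ring
  refine h1.trans ((mul_le_mul_of_nonneg_right h2 (Real.sqrt_nonneg _)).trans (le_of_eq ?_))
  rw [vNorm_eq]; ring

/-- The Fourier representation of the trilinear form `∫ ((u · ∇)v) · w`. -/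
noncomputable def trilinearTerm (u v w : H) (p : (Fin 2 → ℤ) × (Fin 2 → ℤ)) : ℂ :=
  ∑ j, ∑ i, coeff u p.1 j * (derivSymbol j p.2 * coeff v p.2 i) * coeff w (-p.1 - p.2) i

theorem hasSum_trilinearTerm {u v : H} (hu : u ∈ DA) (hv : v ∈ V) (w : H) :
    HasSum (trilinearTerm u v w) ((inner ℝ (bilin u v) w : ℝ) : ℂ) := by
  have h : ∀ j i, HasSum (fun p : (Fin 2 → ℤ) × (Fin 2 → ℤ) =>
      coeff u p.1 j * (derivSymbol j p.2 * coeff v p.2 i) * coeff w (-p.1 - p.2) i)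
      (∫ y, comp u j y * comp (pd j v) i y * comp w i y ∂torusMeasure) := by
    intro j i
    refine (hasSum_scoeff_triple (memLp_comp u j) (summable_norm_coeff hu j)
      (memLp_comp (pd j v) i) (memLp_comp w i)).congr_fun fun p => ?_
    rw [← coeff_pd hv]; rfl
  have hint : ∀ j i, Integrable (fun y => comp u j y * comp (pd j v) i y * comp w i y)
      torusMeasure := by
    intro j i
    have h1 := (memLp_comp (pd j v : L2) i).integrable_mul (memLp_comp (w : L2) i)
    refine (h1.bdd_mul (c := supConst * ‖stokes u‖) (memLp_comp u j).1 ?_).congr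
      (Eventually.of_forall fun y => by simp [mul_assoc])
    filter_upwards [ae_norm_le hu] with y hy
    refine le_trans ?_ hy
    simpa [comp] using PiLp.norm_apply_le ((u : L2) y) j
  have hs := hasSum_sum (s := Finset.univ) fun j (_ : j ∈ Finset.univ) =>
    hasSum_sum (s := Finset.univ) fun i (_ : i ∈ Finset.univ) => h j i
  suffices e : ((inner ℝ (bilin u v) w : ℝ) : ℂ)
      = ∑ j, ∑ i, ∫ y, comp u j y * comp (pd j v) i y * comp w i y ∂torusMeasure by
    rw [e]; exact hs
  rw [inner_bilin hu, ← integral_complex_ofReal]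
  simp_rw [← integral_finsetSum _ fun i _ => hint _ i]
  rw [← integral_finsetSum _ fun j _ => integrable_finsetSum _ fun i _ => hint j i]
  congr 1; ext y
  simp [convection, comp, PiLp.inner_apply, Fin.sum_univ_two]
  ring

/-- On a triad k+l+m = 0, exchanging v and w together with l and m adds the symbols to i û_k·(l+m) =
-i û_k·k, which vanishes as u is divergence-free. -/
theorem trilinearTerm_antisymm (u v w : H) (p : (Fin 2 → ℤ) × (Fin 2 → ℤ)) :
    trilinearTerm u v w p + trilinearTerm u w v (tripleFlip _ p) = 0 := by
  have h := sum_mul_coeff_eq_zero u p.1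
  simp only [trilinearTerm, tripleFlip_apply, Fin.sum_univ_two, derivSymbol] at h ⊢
  rw [show -p.1 - (-p.1 - p.2) = p.2 by abel]
  simp only [Pi.sub_apply, Pi.neg_apply]
  push_cast
  linear_combination (-Complex.I * (coeff v p.2 0 * coeff w (-p.1 - p.2) 0
    + coeff v p.2 1 * coeff w (-p.1 - p.2) 1)) * h

theorem inner_bilin_antisymm {u v w : H} (hu : u ∈ DA) (hv : v ∈ V) (hw : w ∈ V) :
    inner ℝ (bilin u v) w = -inner ℝ (bilin u w) v := by
  have h1 := hasSum_trilinearTerm hu hv w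
  have h2 := (tripleFlip (Fin 2 → ℤ)).hasSum_iff.2 (hasSum_trilinearTerm hu hw v)
  have h3 := h1.add h2
  have h4 := h3.unique (hasSum_zero.congr_fun fun p => trilinearTerm_antisymm u v w p)
  have h5 : inner ℝ (bilin u v) w + inner ℝ (bilin u w) v = 0 := by exact_mod_cast h4
  linarith

theorem inner_bilin_self {u v : H} (hu : u ∈ DA) (hv : v ∈ V) :
    inner ℝ (bilin u v) v = 0 := by
  have := inner_bilin_antisymm hu hv hv
  linarith

/-- With w = u - v, the difference is B(w,u) + B(v,w), and (B(v,w),w) = 0. The splitting is done on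
Fourier terms, where it is plain algebra. -/
theorem inner_bilin_sub {u v : H} (hu : u ∈ DA) (hv : v ∈ DA) :
    inner ℝ (bilin u u - bilin v v) (u - v) = inner ℝ (bilin (u - v) u) (u - v) := by
  have hw := sub_mem_DA hu hv
  have h0 := inner_bilin_self hv (DA_subset_V hw)
  have h1 := hasSum_trilinearTerm hu (DA_subset_V hu) (u - v)
  have h2 := hasSum_trilinearTerm hv (DA_subset_V hv) (u - v)
  have h3 := hasSum_trilinearTerm hw (DA_subset_V hu) (u - v)
  have h4 := hasSum_trilinearTerm hv (DA_subset_V hw) (u - v)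
  have h5 := (h1.sub h2).unique ((h3.add h4).congr_fun fun p => ?_)
  · rw [h0] at h5
    rw [inner_sub_left]
    have h6 : inner ℝ (bilin u u) (u - v) - inner ℝ (bilin v v) (u - v)
        = inner ℝ (bilin (u - v) u) (u - v) + 0 := by exact_mod_cast h5
    linarith
  · simp only [trilinearTerm, Fin.sum_univ_two, Submodule.coe_sub, coeff_sub]
    ring

/-- In the plane, k·û_k = 0 makes û_k a multiple of the rotated vector (-k₁,k₀); for k = 0 the
coefficient vanishes. The α_k are stream function coefficients up to a constant. -/
theorem exists_stream (u : H) : ∃ α : (Fin 2 → ℤ) → ℂ,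
    ∀ k, coeff u k 0 = -α k * k 1 ∧ coeff u k 1 = α k * k 0 := by
  have h : ∀ k : Fin 2 → ℤ, ∃ a : ℂ, coeff u k 0 = -a * k 1 ∧ coeff u k 1 = a * k 0 := by
    intro k
    by_cases hk : k = 0
    · exact ⟨0, by subst hk; simp [coeff_zero_mode]⟩
    have hd := sum_mul_coeff_eq_zero u k
    rw [Fin.sum_univ_two] at hd
    by_cases h0 : k 0 = 0
    · have h1 : (k 1 : ℂ) ≠ 0 := by
        intro h1
        apply hk; ext j; fin_cases j
        · exact h0
        · exact_mod_cast h1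
      refine ⟨-coeff u k 0 / k 1, by field_simp, ?_⟩
      rw [h0] at hd ⊢
      simp only [Int.cast_zero, zero_mul, zero_add, mul_zero] at hd ⊢
      exact (mul_eq_zero.1 hd).resolve_left h1
    · have h0' : (k 0 : ℂ) ≠ 0 := by exact_mod_cast h0
      refine ⟨coeff u k 1 / k 0, ?_, by field_simp⟩
      field_simp
      linear_combination hd
  choose α hα using h
  exact ⟨α, hα⟩

/-- The term of a triad is i α_k α_l α_m (k×l)(l·m)|m|². On k+l+m = 0 one has k×l = l×m = m×k and 2
l·m = |k|²-|l|²-|m|², so the sum over the six orderings is a polynomial that vanishes identically.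
-/
theorem inner_bilin_stokes {v : H} (hv : v ∈ DA) : inner ℝ (bilin v v) (stokes v) = 0 := by
  have h := hasSum_trilinearTerm hv (DA_subset_V hv) (stokes v)
  obtain ⟨α, hα⟩ := exists_stream v
  let E := tripleFlip (Fin 2 → ℤ)
  let S := Equiv.prodComm (Fin 2 → ℤ) (Fin 2 → ℤ)
  -- S exchanges k and l, E exchanges l and m. The six words id, S, E, SE, ES, SES run through all
  -- permutations of the triad, and each rearranged series has the same sum.
  have h1 := S.hasSum_iff.2 h
  have h2 := E.hasSum_iff.2 h
  have h3 := E.hasSum_iff.2 h1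
  have h4 := S.hasSum_iff.2 h2
  have h5 := S.hasSum_iff.2 h3
  have h6 := ((h.add h1).add (h2.add h3)).add (h4.add h5)
  have h7 := h6.unique (hasSum_zero.congr_fun fun p => ?_)
  · have h8 : (6 : ℂ) * ((inner ℝ (bilin v v) (stokes v) : ℝ) : ℂ) = 0 := by
      rw [← h7]; ring
    simpa using h8
  · obtain ⟨k, l⟩ := p
    obtain ⟨m, hm⟩ : ∃ m, m = -k - l := ⟨_, rfl⟩
    have hm0 : (m 0 : ℂ) = -k 0 - l 0 := by rw [hm]; simp
    have hm1 : (m 1 : ℂ) = -k 1 - l 1 := by rw [hm]; simp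
    have e1 : -l - k = m := by rw [hm]; abel
    have e2 : -k - m = l := by rw [hm]; abel
    have e3 : -m - k = l := by rw [hm]; abel
    have e4 : -l - m = k := by rw [hm]; abel
    have e5 : -m - l = k := by rw [hm]; abel
    simp only [Function.comp_apply, E, S, tripleFlip_apply, Equiv.prodComm_apply, Prod.swap,
      trilinearTerm, Fin.sum_univ_two, coeff_stokes hv, derivSymbol, stokesSymbol,
      sq_norm_waveVector, ← hm, e1, e2, e3, e4, e5, (hα k).1, (hα k).2, (hα l).1, (hα l).2,
      (hα m).1, (hα m).2]
    push_cast
    rw [hm0, hm1]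
    ring

end Convection

/-! ### Absolutely continuous functions of time and Grönwall's inequality. -/

section Primitives

open intervalIntegral Set

/-- `x` is a primitive of the locally integrable function `X` on `[0, ∞)`. -/
def IsPrimitiveOf {E : Type*} [NormedAddCommGroup E] [NormedSpace ℝ E] (x X : ℝ → E) : Prop :=
  ∀ t, 0 ≤ t → IntervalIntegrable X volume 0 t ∧ x t = x 0 + ∫ s in (0 : ℝ)..t, X s

theorem intervalIntegrable_of_zero {E : Type*} [NormedAddCommGroup E] {X : ℝ → E}
    (h : ∀ t, 0 ≤ t → IntervalIntegrable X volume 0 t) {s t : ℝ} (hs : 0 ≤ s) (ht : 0 ≤ t) :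
    IntervalIntegrable X volume s t := (h s hs).symm.trans (h t ht)

theorem _root_.AbsolutelyContinuousOnInterval.of_dist_le {X Y : Type*} [PseudoMetricSpace X]
    [PseudoMetricSpace Y] {f : ℝ → X} {g : ℝ → Y} {a b K : ℝ}
    (hg : AbsolutelyContinuousOnInterval g a b)
    (h : ∀ x ∈ uIcc a b, ∀ y ∈ uIcc a b, dist (f x) (f y) ≤ K * dist (g x) (g y)) :
    AbsolutelyContinuousOnInterval f a b := by
  have hK := (Tendsto.const_mul K hg)
  rw [mul_zero] at hK
  refine squeeze_zero' (Eventually.of_forall fun E => Finset.sum_nonneg fun _ _ => dist_nonneg)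
    ?_ hK
  refine eventually_inf_principal.2 (Eventually.of_forall fun E hE => ?_)
  rw [Finset.mul_sum]
  exact Finset.sum_le_sum fun i hi => h _ (hE.1 i hi).1 _ (hE.1 i hi).2

variable {E : Type*} [NormedAddCommGroup E]

section Normed

variable [NormedSpace ℝ E] {x X : ℝ → E}

theorem IsPrimitiveOf.intervalIntegrable (h : IsPrimitiveOf x X) {s t : ℝ} (hs : 0 ≤ s)
    (ht : 0 ≤ t) : IntervalIntegrable X volume s t :=
  intervalIntegrable_of_zero (fun t ht => (h t ht).1) hs ht

theorem IsPrimitiveOf.sub_eq (h : IsPrimitiveOf x X) {s t : ℝ} (hs : 0 ≤ s) (ht : 0 ≤ t) :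
    x t - x s = ∫ r in s..t, X r := by
  rw [(h t ht).2, (h s hs).2, add_sub_add_left_eq_sub,
    integral_interval_sub_left (h t ht).1 (h s hs).1]

theorem IsPrimitiveOf.sub {y Y : ℝ → E} (h : IsPrimitiveOf x X) (h' : IsPrimitiveOf y Y) :
    IsPrimitiveOf (fun t => x t - y t) (fun t => X t - Y t) := fun t ht => by
  refine ⟨(h t ht).1.sub (h' t ht).1, ?_⟩
  change x t - y t = x 0 - y 0 + _
  rw [integral_sub (h t ht).1 (h' t ht).1, (h t ht).2, (h' t ht).2]
  abel

theorem IsPrimitiveOf.sum {ι : Type*} {s : Finset ι} {x X : ι → ℝ → E}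
    (h : ∀ i ∈ s, IsPrimitiveOf (x i) (X i)) :
    IsPrimitiveOf (fun t => ∑ i ∈ s, x i t) (fun t => ∑ i ∈ s, X i t) := fun t ht => by
  refine ⟨by
    simpa only [Finset.sum_fn] using IntervalIntegrable.sum s fun i hi => (h i hi t ht).1, ?_⟩
  rw [integral_finsetSum fun i hi => (h i hi t ht).1, ← Finset.sum_add_distrib]
  exact Finset.sum_congr rfl fun i hi => (h i hi t ht).2

theorem IsPrimitiveOf.clm {F : Type*} [NormedAddCommGroup F] [NormedSpace ℝ F] [CompleteSpace E]
    [CompleteSpace F] (h : IsPrimitiveOf x X) (L : E →L[ℝ] F) :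
    IsPrimitiveOf (fun t => L (x t)) (fun t => L (X t)) := fun t ht => by
  refine ⟨⟨L.integrable_comp (h t ht).1.1, L.integrable_comp (h t ht).1.2⟩, ?_⟩
  change L (x t) = L (x 0) + _
  rw [(h t ht).2, map_add, L.intervalIntegral_comp_comm (h t ht).1]

theorem IsPrimitiveOf.absolutelyContinuousOnInterval (h : IsPrimitiveOf x X) {a b : ℝ}
    (ha : 0 ≤ a) (hb : 0 ≤ b) : AbsolutelyContinuousOnInterval x a b := by
  have hN : ∀ {s t : ℝ}, 0 ≤ s → 0 ≤ t → IntervalIntegrable (fun r => ‖X r‖) volume s t :=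
    fun hs ht => (h.intervalIntegrable hs ht).norm
  -- Increments of x are dominated by those of the primitive of ‖X‖.
  refine ((hN ha hb).absolutelyContinuousOnInterval_intervalIntegral
    (left_mem_uIcc)).of_dist_le (K := 1) fun s hs t ht => ?_
  have hs0 : 0 ≤ s := (le_min ha hb).trans hs.1
  have ht0 : 0 ≤ t := (le_min ha hb).trans ht.1
  rw [one_mul, dist_eq_norm, dist_eq_norm, h.sub_eq ht0 hs0,
    integral_interval_sub_left (hN ha hs0) (hN ha ht0), Real.norm_eq_abs]
  exact norm_integral_le_abs_integral_norm

theorem IsPrimitiveOf.continuousOn (h : IsPrimitiveOf x X) : ContinuousOn x (Ici 0) := by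
  intro t ht
  have ht' : (0 : ℝ) ≤ t := ht
  have h1 := (h.absolutelyContinuousOnInterval le_rfl
    (show (0 : ℝ) ≤ t + 1 by linarith)).continuousOn t
    (by rw [uIcc_of_le (by linarith)]; exact ⟨ht', by linarith⟩)
  refine h1.mono_of_mem_nhdsWithin ?_
  rw [uIcc_of_le (by linarith)]
  filter_upwards [self_mem_nhdsWithin,
    mem_nhdsWithin_of_mem_nhds (Iio_mem_nhds (show t < t + 1 by linarith))] with s h2 h3
  exact ⟨h2, le_of_lt h3⟩

theorem IsPrimitiveOf.ae_hasDerivAt [CompleteSpace E] (h : IsPrimitiveOf x X) :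
    ∀ᵐ t ∂timeMeasure, HasDerivAt x (X t) t := by
  rw [ae_restrict_iff' measurableSet_Ioi]
  have h1 : ∀ n : ℕ, ∀ᵐ t, t ∈ uIcc (0 : ℝ) n → ∀ c ∈ uIcc (0 : ℝ) n,
      HasDerivAt (fun t => ∫ s in c..t, X s) (X t) t := fun n =>
    ((h n n.cast_nonneg).1).ae_hasDerivAt_integral
  filter_upwards [ae_all_iff.2 h1] with t ht h0
  obtain ⟨n, hn⟩ := exists_nat_gt t
  have h0' : (0 : ℝ) < t := h0
  have h2 := (ht n (by rw [uIcc_of_le (h0'.trans hn).le]; exact ⟨h0'.le, hn.le⟩) 0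
    left_mem_uIcc).const_add (x 0)
  refine h2.congr_of_eventuallyEq ?_
  filter_upwards [Ioi_mem_nhds h0'] with s hs
  exact (h s (le_of_lt hs)).2

end Normed

/-- A function that is absolutely continuous with the derivative `Φ` is a primitive of `Φ`. -/
theorem isPrimitiveOf_of_ae_hasDerivAt {φ Φ : ℝ → ℝ}
    (hac : ∀ t, 0 ≤ t → AbsolutelyContinuousOnInterval φ 0 t)
    (hd : ∀ᵐ t ∂timeMeasure, HasDerivAt φ (Φ t) t) : IsPrimitiveOf φ Φ := by
  rw [ae_restrict_iff' measurableSet_Ioi] at hd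
  intro t ht
  have he : ∀ᵐ s, s ∈ uIoc 0 t → deriv φ s = Φ s := by
    filter_upwards [hd] with s hs hst
    rw [uIoc_of_le ht] at hst
    exact (hs hst.1).deriv
  refine ⟨(hac t ht).intervalIntegrable_deriv.congr_ae ?_, ?_⟩
  · exact (ae_restrict_iff' measurableSet_uIoc).2 he
  · rw [← integral_congr_ae he, (hac t ht).integral_deriv_eq_sub]
    ring

/-- The squared norm is Lipschitz on bounded sets, so absolute continuity survives, and the chain
rule holds at almost every time. -/
theorem IsPrimitiveOf.normSq [InnerProductSpace ℝ E] [CompleteSpace E] {x X : ℝ → E}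
    (h : IsPrimitiveOf x X) :
    IsPrimitiveOf (fun t => ‖x t‖ ^ 2) (fun t => 2 * inner ℝ (x t) (X t)) := by
  refine isPrimitiveOf_of_ae_hasDerivAt (fun t ht => ?_) ?_
  · have hx := h.absolutelyContinuousOnInterval le_rfl ht
    obtain ⟨C, hC⟩ := hx.exists_bound
    refine hx.of_dist_le (K := 2 * C) fun r hr s hs => ?_
    rw [Real.dist_eq, sq_sub_sq, abs_mul, dist_eq_norm]
    have h1 := hC r hr
    have h2 := hC s hs
    have h3 : |‖x r‖ + ‖x s‖| ≤ 2 * C := by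
      rw [abs_of_nonneg (by positivity)]; linarith
    exact mul_le_mul h3 (abs_norm_sub_norm_le _ _) (abs_nonneg _)
      ((abs_nonneg _).trans h3)
  · filter_upwards [h.ae_hasDerivAt] with t ht
    exact ht.norm_sq

/-- Grönwall's inequality with a locally integrable coefficient. -/
theorem IsPrimitiveOf.gronwall {ξ Ξ α : ℝ → ℝ} (h : IsPrimitiveOf ξ Ξ)
    (hα : ∀ t, 0 ≤ t → IntervalIntegrable α volume 0 t) {T t ε a K : ℝ} (hT : 0 ≤ T)
    (hTt : T ≤ t) (hε : 0 ≤ ε) (ha : 0 < a) (h0 : 0 ≤ ξ T)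
    (hle : ∀ᵐ s ∂timeMeasure, T ≤ s → Ξ s ≤ -(α s * ξ s) + ε)
    (hK : ∀ s, T ≤ s → s ≤ t → a * (t - s) - K ≤ ∫ r in s..t, α r) :
    ξ t ≤ Real.exp (K - a * (t - T)) * ξ T + ε * (Real.exp K / a) := by
  have ht : 0 ≤ t := hT.trans hTt
  -- Integrating factor: exp(A) ξ has derivative at most ε exp(A) after time T.
  set A : ℝ → ℝ := fun s => ∫ r in (0 : ℝ)..s, α r with hA
  have hAp : IsPrimitiveOf A α := fun s hs => ⟨hα s hs, by simp [hA]⟩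
  have hexp : AbsolutelyContinuousOnInterval (fun s => Real.exp (A s)) T t := by
    have hAac := hAp.absolutelyContinuousOnInterval hT ht
    obtain ⟨C, hC⟩ := hAac.exists_bound
    refine hAac.of_dist_le (K := Real.exp C) fun r hr s hs => ?_
    rw [Real.dist_eq, Real.dist_eq, ← Real.norm_eq_abs, ← Real.norm_eq_abs]
    -- A is bounded by C on the interval, and exp is Lipschitz with constant exp(C) on (-∞, C].
    refine (convex_Iic C).norm_image_sub_le_of_norm_deriv_le (𝕜 := ℝ) (f := Real.exp)
      (fun y _ => Real.differentiable_exp y) (fun y hy => ?_)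
      ((le_abs_self _).trans (hC s hs)) ((le_abs_self _).trans (hC r hr))
    rw [Real.deriv_exp, Real.norm_of_nonneg (Real.exp_pos y).le]
    exact Real.exp_le_exp.2 hy
  have hξ := h.absolutelyContinuousOnInterval hT ht
  have hψ := hexp.fun_mul hξ
  have hint := hψ.integral_deriv_eq_sub
  have hAc : ContinuousOn A (uIcc T t) := (hAp.absolutelyContinuousOnInterval hT ht).continuousOn
  have hecont : ContinuousOn (fun s => ε * Real.exp (A s)) (uIcc T t) :=
    continuousOn_const.mul (Real.continuous_exp.comp_continuousOn hAc)
  have hmono : (∫ s in T..t, deriv (fun s => Real.exp (A s) * ξ s) s)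
      ≤ ∫ s in T..t, ε * Real.exp (A s) := by
    refine integral_mono_ae_restrict hTt hψ.intervalIntegrable_deriv
      hecont.intervalIntegrable ?_
    have h1 := h.ae_hasDerivAt
    have h2 := hAp.ae_hasDerivAt
    rw [EventuallyLE, ae_restrict_iff' measurableSet_Icc]
    have h3 := (ae_restrict_iff' measurableSet_Ioi).1 ((h1.and h2).and hle)
    -- The closed interval may contain time 0, where the hypotheses on (0,∞) say nothing.
    have h4 : ∀ᵐ s : ℝ, s ≠ 0 := by simp [ae_iff, measure_singleton]
    filter_upwards [h3, h4] with s hs hs0 hsT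
    have hs1 : 0 < s := lt_of_le_of_ne (hT.trans hsT.1) (Ne.symm hs0)
    obtain ⟨⟨d1, d2⟩, d3⟩ := hs hs1
    have d4 : HasDerivAt (fun s => Real.exp (A s) * ξ s) _ s := d2.exp.mul d1
    rw [d4.deriv]
    have := mul_le_mul_of_nonneg_left (d3 hsT.1) (Real.exp_pos (A s)).le
    linarith
  rw [hint] at hmono
  have hdiff : ∀ s, T ≤ s → s ≤ t → A s - A t ≤ K - a * (t - s) := by
    intro s hs hst
    have h1 := hK s hs hst
    have h2 := hAp.sub_eq (hT.trans hs) ht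
    linarith
  have hpos := Real.exp_pos (A t)
  have hI : (∫ s in T..t, ε * Real.exp (A s)) ≤ Real.exp (A t) * (ε * (Real.exp K / a)) := by
    have h1 : (∫ s in T..t, ε * Real.exp (A s))
        ≤ ∫ s in T..t, (ε * Real.exp (A t) * Real.exp K) * Real.exp (a * s - a * t) := by
      refine integral_mono_on hTt hecont.intervalIntegrable
        (Continuous.intervalIntegrable (by fun_prop) _ _) fun s hs => ?_
      have h2 : Real.exp (A s) ≤ Real.exp (A t) * Real.exp K * Real.exp (a * s - a * t) := by
        rw [← Real.exp_add, ← Real.exp_add]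
        refine Real.exp_le_exp.2 ?_
        have := hdiff s hs.1 hs.2
        linarith
      have := mul_le_mul_of_nonneg_left h2 hε
      linarith
    have h2 : (∫ s in T..t, Real.exp (a * s - a * t)) ≤ 1 / a := by
      have hd : ∀ s ∈ uIcc T t, HasDerivAt (fun s => Real.exp (a * s - a * t) / a)
          (Real.exp (a * s - a * t)) s := by
        intro s _
        have := ((((hasDerivAt_id s).const_mul a).sub_const (a * t)).exp).div_const a
        simp only [id, mul_one] at this
        rwa [mul_div_assoc, div_self ha.ne', mul_one] at this
      rw [integral_eq_sub_of_hasDerivAt hd (Continuous.intervalIntegrable (by fun_prop) _ _),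
        sub_self, Real.exp_zero]
      have : 0 ≤ Real.exp (a * T - a * t) / a := by positivity
      linarith
    rw [intervalIntegral.integral_const_mul (ε * Real.exp (A t) * Real.exp K)] at h1
    have h3 : 0 ≤ ε * Real.exp (A t) * Real.exp K := by positivity
    refine h1.trans ((mul_le_mul_of_nonneg_left h2 h3).trans (le_of_eq ?_))
    ring
  have hT1 : Real.exp (A T) * ξ T ≤ Real.exp (A t) * (Real.exp (K - a * (t - T)) * ξ T) := by
    rw [← mul_assoc, ← Real.exp_add]
    refine mul_le_mul_of_nonneg_right (Real.exp_le_exp.2 ?_) h0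
    have := hdiff T le_rfl hTt
    linarith
  refine le_of_mul_le_mul_left ?_ hpos
  rw [mul_add]
  linarith

theorem IsPrimitiveOf.le_add_of_le {ξ Ξ : ℝ → ℝ} (h : IsPrimitiveOf ξ Ξ) (h0 : ∀ t, 0 ≤ t → 0 ≤ ξ t)
    {c d : ℝ} (hc : 0 < c) (hd : 0 ≤ d)
    (hle : ∀ᵐ s ∂timeMeasure, Ξ s ≤ -(c * ξ s) + d) {t : ℝ} (ht : 0 ≤ t) :
    ξ t ≤ ξ 0 + d / c := by
  have h1 := h.gronwall (α := fun _ => c) (fun t _ => _root_.intervalIntegrable_const) le_rfl ht hd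
    hc (h0 0 le_rfl) (K := 0) (hle.mono fun s hs _ => hs) (fun s _ _ => by
      rw [intervalIntegral.integral_const, smul_eq_mul]; linarith)
  have h2 : Real.exp (0 - c * (t - 0)) ≤ 1 := by
    rw [Real.exp_le_one_iff]
    have := mul_nonneg hc.le ht
    linarith
  have h3 := mul_le_mul_of_nonneg_right h2 (h0 0 le_rfl)
  rw [Real.exp_zero] at h1
  rw [div_eq_mul_one_div]
  linarith

/-- Integrate the differential inequality and drop φ(t) ≥ 0. -/
theorem IsPrimitiveOf.integral_le {φ Φ D : ℝ → ℝ} (h : IsPrimitiveOf φ Φ)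
    (h0 : ∀ t, 0 ≤ t → 0 ≤ φ t) (hD : ∀ t, 0 ≤ t → IntervalIntegrable D volume 0 t) {c : ℝ}
    (hle : ∀ᵐ s ∂timeMeasure, Φ s ≤ -D s + c) {s t : ℝ} (hs : 0 ≤ s) (hst : s ≤ t) :
    ∫ r in s..t, D r ≤ φ s + c * (t - s) := by
  have ht := hs.trans hst
  have hDi := intervalIntegrable_of_zero hD hs ht
  have h1 : (∫ r in s..t, Φ r) ≤ ∫ r in s..t, (-D r + c) := by
    refine integral_mono_ae_restrict hst (h.intervalIntegrable hs ht)
      (hDi.neg.add _root_.intervalIntegrable_const) ?_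
    rw [EventuallyLE, ae_restrict_iff' measurableSet_Icc]
    have h4 : ∀ᵐ s : ℝ, s ≠ 0 := by simp [ae_iff, measure_singleton]
    filter_upwards [(ae_restrict_iff' measurableSet_Ioi).1 hle, h4] with r hr hr0 hrs
    exact hr (lt_of_le_of_ne (hs.trans hrs.1) (Ne.symm hr0))
  rw [← h.sub_eq hs ht] at h1
  have h2 : (∫ r in s..t, (-D r + c)) = (∫ r in s..t, -D r) + ∫ _ in s..t, c :=
    integral_add hDi.neg _root_.intervalIntegrable_const
  rw [h2, intervalIntegral.integral_neg, intervalIntegral.integral_const, smul_eq_mul] at h1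
  have := h0 t ht
  linarith

/-- Grönwall's inequality started at a late time T, after which β is small. The constant K must not
depend on the starting time, since T depends on ε. -/
theorem IsPrimitiveOf.tendsto_zero {ξ Ξ α β : ℝ → ℝ} (h : IsPrimitiveOf ξ Ξ)
    (h0 : ∀ t, 0 ≤ t → 0 ≤ ξ t) (hα : ∀ t, 0 ≤ t → IntervalIntegrable α volume 0 t) {a K : ℝ}
    (ha : 0 < a) (hK : ∀ s t, 0 ≤ s → s ≤ t → a * (t - s) - K ≤ ∫ r in s..t, α r)
    (hle : ∀ᵐ s ∂timeMeasure, Ξ s ≤ -(α s * ξ s) + β s)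
    (hβ : ∀ ε > 0, ∃ T, 0 ≤ T ∧ ∀ᵐ s ∂timeMeasure, T ≤ s → β s ≤ ε) :
    Tendsto ξ atTop (𝓝 0) := by
  rw [Metric.tendsto_atTop]
  intro ε hε
  -- Solves δ exp(K)/a = ε/2, the contribution of the forcing.
  set δ := ε / 2 * (a / Real.exp K) with hδ
  have hδ0 : 0 < δ := by positivity
  obtain ⟨T, hT, hT'⟩ := hβ δ hδ0
  have hlim : Tendsto (fun t => Real.exp (K - a * (t - T)) * ξ T) atTop (𝓝 0) := by
    rw [← zero_mul (ξ T)]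
    refine Tendsto.mul_const _ (Real.tendsto_exp_atBot.comp ?_)
    have h1 : Tendsto (fun t : ℝ => a * (t - T)) atTop atTop :=
      (tendsto_atTop_add_const_right _ (-T) tendsto_id).const_mul_atTop ha
    exact tendsto_atBot_add_const_left _ K (tendsto_neg_atTop_atBot.comp h1)
  obtain ⟨S, hS⟩ := eventually_atTop.1 (hlim.eventually_lt_const (show 0 < ε / 2 by linarith))
  refine ⟨max S T, fun t ht => ?_⟩
  have htT : T ≤ t := (le_max_right _ _).trans ht
  have h1 := h.gronwall hα hT htT hδ0.le ha (h0 T hT) (K := K)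
    (by filter_upwards [hle, hT'] with s h1 h2 h3
        have := h2 h3; linarith) fun s hs hst => hK s t (hT.trans hs) hst
  have h2 := hS t ((le_max_left _ _).trans ht)
  have h3 : δ * (Real.exp K / a) = ε / 2 := by
    have := Real.exp_pos K
    rw [hδ]; field_simp
  rw [Real.dist_eq, sub_zero, abs_of_nonneg (h0 t (hT.trans htT))]
  linarith

end Primitives

/-! ### The enstrophy identity and essential suprema in time. -/

section Enstrophy

open Set

theorem inner_sum_le_norm_sq {ι : Type*} {s : Finset ι} {E : Type*} [NormedAddCommGroup E]
    [InnerProductSpace ℝ E] (a b : ι → E) :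
    ∑ i ∈ s, 2 * |inner ℝ (a i) (b i)| ≤ ∑ i ∈ s, ‖a i‖ ^ 2 + ∑ i ∈ s, ‖b i‖ ^ 2 := by
  rw [← Finset.sum_add_distrib]
  refine Finset.sum_le_sum fun i _ => ?_
  have := abs_real_inner_le_norm (a i) (b i)
  nlinarith [sq_nonneg (‖a i‖ - ‖b i‖)]

theorem two_mul_abs_modeInner_le (u v : L2) (k : Fin 2 → ℤ) :
    2 * |modeInner u v k| ≤ modeInner u u k + modeInner v v k := by
  rw [modeInner_self, modeInner_self]
  refine le_trans ?_ (inner_sum_le_norm_sq (s := Finset.univ) (fun i => coeff u k i)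
    fun i => coeff v k i)
  rw [← Finset.mul_sum]
  exact mul_le_mul_of_nonneg_left (Finset.abs_sum_le_sum_abs _ _) zero_le_two

theorem sum_abs_modeInner_le (u v : L2) (s : Finset (Fin 2 → ℤ)) :
    ∑ k ∈ s, 2 * |modeInner u v k| ≤ ‖u‖ ^ 2 + ‖v‖ ^ 2 := by
  have hu : ∑ k ∈ s, modeInner u u k ≤ ‖u‖ ^ 2 := by
    rw [← real_inner_self_eq_norm_sq]
    exact sum_le_hasSum s (fun k _ => modeInner_self_nonneg u k) (hasSum_modeInner u u)
  have hv : ∑ k ∈ s, modeInner v v k ≤ ‖v‖ ^ 2 := by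
    rw [← real_inner_self_eq_norm_sq]
    exact sum_le_hasSum s (fun k _ => modeInner_self_nonneg v k) (hasSum_modeInner v v)
  have h := Finset.sum_le_sum fun k (_ : k ∈ s) => two_mul_abs_modeInner_le u v k
  rw [Finset.sum_add_distrib] at h
  linarith

theorem memLp_uIoc {E : Type*} [NormedAddCommGroup E] {f : ℝ → E} {p : ℝ≥0∞}
    (hf : ∀ T : ℝ, 0 < T → MemLp f p (volume.restrict (Ioo 0 T))) {t : ℝ} (ht : 0 ≤ t) :
    MemLp f p (volume.restrict (uIoc 0 t)) := by
  rw [uIoc_of_le ht]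
  rcases ht.eq_or_lt with rfl | h
  · simp
  · rw [← Measure.restrict_congr_set Ioo_ae_eq_Ioc]
    exact hf t h

theorem ae_uIoc_of_ae_timeMeasure {p : ℝ → Prop} (h : ∀ᵐ s ∂timeMeasure, p s) {t : ℝ}
    (ht : 0 ≤ t) : ∀ᵐ s, s ∈ uIoc 0 t → p s := by
  filter_upwards [(ae_restrict_iff' measurableSet_Ioi).1 h] with s hs hst
  rw [uIoc_of_le ht] at hst
  exact hs hst.1

theorem IsPrimitiveOf.const_mul {x X : ℝ → ℝ} (h : IsPrimitiveOf x X) (c : ℝ) :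
    IsPrimitiveOf (fun t => c * x t) (fun t => c * X t) := fun t ht => by
  refine ⟨(h t ht).1.const_mul c, ?_⟩
  rw [intervalIntegral.integral_const_mul, ← mul_add, ← (h t ht).2]

/-- For finitely many modes this is the product rule. The passage to all modes uses dominated
convergence with majorant ‖Ax‖² + ‖X‖², which is integrable because Ax and X both lie in L²(0,T;H).
-/
theorem IsPrimitiveOf.gradSq {x X : ℝ → H} (h : IsPrimitiveOf x X) (hV : ∀ t, 0 ≤ t → x t ∈ V)
    (hDA : ∀ᵐ t ∂timeMeasure, x t ∈ DA)
    (hA : ∀ T : ℝ, 0 < T → MemLp (fun t => stokes (x t)) 2 (volume.restrict (Ioo 0 T)))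
    (hX : ∀ T : ℝ, 0 < T → MemLp X 2 (volume.restrict (Ioo 0 T))) :
    IsPrimitiveOf (fun t => gradSq (x t)) (fun t => 2 * inner ℝ (stokes (x t)) (X t)) := by
  have hmode : ∀ k : Fin 2 → ℤ, IsPrimitiveOf
      (fun t => ‖waveVector k‖ ^ 2 * modeInner (x t) (x t) k)
      (fun t => ‖waveVector k‖ ^ 2 * (2 * modeInner (x t) (X t) k)) := by
    intro k
    refine IsPrimitiveOf.const_mul ?_ _
    have h1 := IsPrimitiveOf.sum (s := Finset.univ) fun i (_ : i ∈ Finset.univ) =>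
      (h.clm ((coeffCLM k i).comp H.subtypeL)).normSq
    convert h1 using 2 with t t
    · exact modeInner_self _ _
    · exact Finset.mul_sum _ _ _
  have hsum : ∀ s : Finset (Fin 2 → ℤ), IsPrimitiveOf
      (fun t => ∑ k ∈ s, ‖waveVector k‖ ^ 2 * modeInner (x t) (x t) k)
      (fun t => ∑ k ∈ s, ‖waveVector k‖ ^ 2 * (2 * modeInner (x t) (X t) k)) :=
    fun s => IsPrimitiveOf.sum fun k _ => hmode k
  intro t ht
  have hAt := memLp_uIoc hA ht
  have hXt := memLp_uIoc hX ht
  have hbound : IntervalIntegrable (fun s => ‖stokes (x s)‖ ^ 2 + ‖X s‖ ^ 2) volume 0 t := by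
    rw [intervalIntegrable_iff]
    exact (hAt.integrable_norm_pow two_ne_zero).add (hXt.integrable_norm_pow two_ne_zero)
  have hle : ∀ a b : H, ‖2 * inner ℝ a b‖ ≤ ‖a‖ ^ 2 + ‖b‖ ^ 2 := by
    intro a b
    rw [Real.norm_eq_abs, abs_mul, abs_two]
    have := abs_real_inner_le_norm a b
    nlinarith [sq_nonneg (‖a‖ - ‖b‖)]
  refine ⟨?_, ?_⟩
  · rw [intervalIntegrable_iff] at hbound ⊢
    exact Integrable.mono' hbound ((hAt.1.inner hXt.1).const_mul 2)
      (Eventually.of_forall fun s => hle _ _)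
  · have hlim1 : Tendsto (fun s : Finset (Fin 2 → ℤ) => ∫ r in (0 : ℝ)..t,
        ∑ k ∈ s, ‖waveVector k‖ ^ 2 * (2 * modeInner (x r) (X r) k)) atTop
        (𝓝 (∫ r in (0 : ℝ)..t, 2 * inner ℝ (stokes (x r)) (X r))) := by
      have hDAt := ae_uIoc_of_ae_timeMeasure hDA ht
      have hrw : ∀ {r : ℝ}, x r ∈ DA → ∀ k,
          ‖waveVector k‖ ^ 2 * (2 * modeInner (x r) (X r) k)
            = 2 * modeInner (stokes (x r)) (X r) k := by
        intro r hr k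
        rw [modeInner_stokes_left hr]; ring
      refine intervalIntegral.tendsto_integral_filter_of_dominated_convergence _
        (Eventually.of_forall fun s => ?_) (Eventually.of_forall fun s => ?_) hbound ?_
      · exact (intervalIntegrable_iff.1 ((hsum s) t ht).1).aestronglyMeasurable
      · filter_upwards [hDAt] with r hr hrt
        simp_rw [hrw (hr hrt)]
        refine le_trans (Finset.abs_sum_le_sum_abs _ _) ?_
        simp_rw [abs_mul, abs_two]
        exact sum_abs_modeInner_le _ _ s
      · filter_upwards [hDAt] with r hr hrt
        simp_rw [hrw (hr hrt)]
        exact (hasSum_modeInner (stokes (x r) : L2) (X r : L2)).mul_left 2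
    have hlim2 : Tendsto (fun s : Finset (Fin 2 → ℤ) => ∫ r in (0 : ℝ)..t,
        ∑ k ∈ s, ‖waveVector k‖ ^ 2 * (2 * modeInner (x r) (X r) k)) atTop
        (𝓝 (PeriodicNSE.gradSq (x t) - PeriodicNSE.gradSq (x 0))) := by
      have h1 := Tendsto.sub (hasSum_gradSq (hV t ht)) (hasSum_gradSq (hV 0 le_rfl))
      refine h1.congr fun s => ?_
      exact (hsum s).sub_eq le_rfl ht
    rw [tendsto_nhds_unique hlim1 hlim2]
    ring

theorem sqrt_gradSq_eq_norm (u : H) :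
    Real.sqrt (gradSq u) = ‖(WithLp.toLp 2 fun j => pd j u : PiLp 2 fun _ : Fin 2 => H)‖ := by
  rw [PiLp.norm_eq_of_L2]; rfl

theorem abs_sqrt_gradSq_sub_le {u v : H} (hu : u ∈ V) (hv : v ∈ V) :
    |Real.sqrt (gradSq u) - Real.sqrt (gradSq v)| ≤ Real.sqrt (gradSq (u - v)) := by
  simp_rw [sqrt_gradSq_eq_norm]
  refine (abs_norm_sub_norm_le _ _).trans (le_of_eq ?_)
  congr 1
  ext j
  simp [pd_sub hu hv]

theorem continuousOn_gradSq {x : ℝ → H} (hV : ∀ t, 0 ≤ t → x t ∈ V)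
    (hc : ∀ t₀, 0 ≤ t₀ → Tendsto (fun t => vNorm (x t - x t₀)) (𝓝[Ici 0] t₀) (𝓝 0)) :
    ContinuousOn (fun t => gradSq (x t)) (Ici 0) := by
  have h1 : ContinuousOn (fun t => Real.sqrt (gradSq (x t))) (Ici 0) := by
    intro t₀ ht₀
    have h2 := (hc t₀ ht₀).const_mul (2 * Real.pi)⁻¹
    rw [mul_zero] at h2
    refine tendsto_iff_dist_tendsto_zero.2 (squeeze_zero' (Eventually.of_forall fun _ =>
      dist_nonneg) ?_ h2)
    filter_upwards [self_mem_nhdsWithin] with t ht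
    rw [Real.dist_eq, vNorm_eq, inv_mul_cancel_left₀ (by positivity)]
    exact abs_sqrt_gradSq_sub_le (hV t ht) (hV t₀ ht₀)
  refine (h1.pow 2).congr fun t _ => ?_
  exact (Real.sq_sqrt (gradSq_nonneg _)).symm

/-- The bound C serves only to make the essential supremum finite; an infinite one would be read as
0. -/
theorem ae_le_timeSup {a : ℝ → ℝ} {C : ℝ} (ha : ∀ᵐ t ∂timeMeasure, |a t| ≤ C) :
    ∀ᵐ t ∂timeMeasure, a t ≤ timeSup a := by
  have hfin : eLpNormEssSup a timeMeasure < ∞ := eLpNormEssSup_lt_top_of_ae_bound ha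
  unfold timeSup
  rw [eLpNorm_exponent_top]
  filter_upwards [ae_le_eLpNormEssSup (f := a) (μ := timeMeasure)] with t ht
  have := ENNReal.toReal_mono hfin.ne ht
  refine le_trans (le_abs_self _) ?_
  simpa using this

theorem exists_ae_norm_le {E : Type*} [NormedAddCommGroup E] {g : ℝ → E}
    (hg : MemLp g ∞ timeMeasure) : ∃ C, 0 ≤ C ∧ ∀ᵐ t ∂timeMeasure, ‖g t‖ ≤ C := by
  have hfin := hg.2
  rw [eLpNorm_exponent_top] at hfin
  refine ⟨(eLpNormEssSup g timeMeasure).toReal, ENNReal.toReal_nonneg, ?_⟩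
  filter_upwards [ae_le_eLpNormEssSup (f := g) (μ := timeMeasure)] with t ht
  simpa using ENNReal.toReal_mono hfin.ne ht

end Enstrophy

/-! ### Differential inequalities at a fixed time. -/

section Estimates

/-- The time derivative prescribed by the symmetric nudging intertwinement. -/
noncomputable def nudgedRhs (ν μ₁ μ₂ N : ℝ) (f u : Fin 2 → H) (j : Fin 2) : H :=
  f j + ∑ l, nudgingMatrix μ₁ μ₂ j l • nudgingFunction N l (u l) - ν • stokes (u j)
    - bilin (u j) (u j)

variable {ν μ₁ μ₂ N : ℝ} {f u : Fin 2 → H}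

theorem nudgedRhs_zero : nudgedRhs ν μ₁ μ₂ N f u 0 = f 0 - μ₁ • lowPass N (u 0)
    + μ₂ • lowPass N (u 1) - ν • stokes (u 0) - bilin (u 0) (u 0) := by
  simp [nudgedRhs, nudgingMatrix, nudgingFunction, Fin.sum_univ_two]
  abel

theorem nudgedRhs_one : nudgedRhs ν μ₁ μ₂ N f u 1 = f 1 + μ₂ • lowPass N (u 0)
    - μ₁ • lowPass N (u 1) - ν • stokes (u 1) - bilin (u 1) (u 1) := by
  simp [nudgedRhs, nudgingMatrix, nudgingFunction, Fin.sum_univ_two]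
  abel

/-- The vectors (1,1) and (1,-1) are eigenvectors with eigenvalues μ₁-μ₂ and μ₁+μ₂. -/
theorem abs_le_of_posSemidef (hM : (nudgingMatrix μ₁ μ₂).PosSemidef) : |μ₂| ≤ μ₁ := by
  have h1 := hM.dotProduct_mulVec_nonneg ![1, 1]
  have h2 := hM.dotProduct_mulVec_nonneg ![1, -1]
  simp [nudgingMatrix, Matrix.mulVec, dotProduct, Fin.sum_univ_two] at h1 h2
  rw [abs_le]
  constructor <;> linarith

theorem coupling_nonneg (hμ : |μ₂| ≤ μ₁) {A B c : ℝ} (hc : 2 * |c| ≤ A + B) :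
    0 ≤ μ₁ * A + μ₁ * B - 2 * (μ₂ * c) := by
  have h1 : μ₂ * c ≤ |μ₂| * |c| := by rw [← abs_mul]; exact le_abs_self _
  have h2 : |μ₂| * (2 * |c|) ≤ |μ₂| * (A + B) := mul_le_mul_of_nonneg_left hc (abs_nonneg _)
  have h3 : |μ₂| * (A + B) ≤ μ₁ * (A + B) :=
    mul_le_mul_of_nonneg_right hμ (le_trans (by positivity) hc)
  linarith

theorem coupling_coercive (hμ : 0 ≤ μ₂) {A B c : ℝ} (hc : 2 * |c| ≤ A + B) :
    (μ₁ - μ₂) * (A + B) ≤ μ₁ * A + μ₁ * B - 2 * (μ₂ * c) := by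
  have h1 : μ₂ * c ≤ μ₂ * |c| := mul_le_mul_of_nonneg_left (le_abs_self _) hμ
  have h2 : μ₂ * (2 * |c|) ≤ μ₂ * (A + B) := mul_le_mul_of_nonneg_left hc hμ
  linarith

theorem two_mul_inner_le (hν : 0 < ν) {E : Type*} [NormedAddCommGroup E] [InnerProductSpace ℝ E]
    (a b : E) : 2 * inner ℝ a b ≤ 1 / ν * ‖a‖ ^ 2 + ν * ‖b‖ ^ 2 := by
  have h1 := real_inner_le_norm a b
  have h2 : 1 / ν * ‖a‖ ^ 2 + ν * ‖b‖ ^ 2 - 2 * (‖a‖ * ‖b‖) = 1 / ν * (‖a‖ - ν * ‖b‖) ^ 2 := by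
    field_simp; ring
  have h3 : 0 ≤ 1 / ν * (‖a‖ - ν * ‖b‖) ^ 2 := by positivity
  linarith

theorem inner_smul_left_H (r : ℝ) (a b : H) : inner ℝ (r • a) b = r * inner ℝ a b :=
  real_inner_smul_left a b r

theorem energy_rate (hu : ∀ j, u j ∈ DA) :
    ∑ j, 2 * inner ℝ (u j) (nudgedRhs ν μ₁ μ₂ N f u j)
      = ∑ j, 2 * inner ℝ (f j) (u j) - 2 * (μ₁ * ‖lowPass N (u 0)‖ ^ 2
        + μ₁ * ‖lowPass N (u 1)‖ ^ 2
        - 2 * (μ₂ * inner ℝ (lowPass N (u 0)) (lowPass N (u 1)))) - 2 * ν * ∑ j, gradSq (u j) := by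
  have h0 := inner_bilin_self (hu 0) (DA_subset_V (hu 0))
  have h1 := inner_bilin_self (hu 1) (DA_subset_V (hu 1))
  simp only [Fin.sum_univ_two]
  rw [nudgedRhs_zero, nudgedRhs_one, real_inner_comm, real_inner_comm _ (u 1)]
  simp only [inner_sub_left, inner_add_left, inner_smul_left_H, h0, h1,
    inner_stokes_self (hu 0), inner_stokes_self (hu 1)]
  have hl := fun i j => inner_lowPass_left N (u i) (u j)
  rw [hl 0 0, hl 0 1, hl 1 0, hl 1 1, real_inner_comm (lowPass N (u 0)) (lowPass N (u 1)),
    real_inner_self_eq_norm_sq, real_inner_self_eq_norm_sq]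
  ring

/-- The coupling only dissipates. Young's inequality for the force costs ν|u|², which Poincaré's
inequality (all |k| ≥ 1) pays from half of the dissipation. -/
theorem energy_rate_le (hν : 0 < ν) (hμ : |μ₂| ≤ μ₁) (hu : ∀ j, u j ∈ DA) :
    ∑ j, 2 * inner ℝ (u j) (nudgedRhs ν μ₁ μ₂ N f u j)
      ≤ -(ν * ∑ j, gradSq (u j)) + 1 / ν * ∑ j, ‖f j‖ ^ 2 := by
  rw [energy_rate hu]
  have hc : 2 * |inner ℝ (lowPass N (u 0)) (lowPass N (u 1))|
      ≤ ‖lowPass N (u 0)‖ ^ 2 + ‖lowPass N (u 1)‖ ^ 2 := by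
    have := abs_real_inner_le_norm (lowPass N (u 0)) (lowPass N (u 1))
    nlinarith [sq_nonneg (‖lowPass N (u 0)‖ - ‖lowPass N (u 1)‖)]
  have h1 := coupling_nonneg hμ hc
  have h2 := fun j => two_mul_inner_le hν (f j) (u j)
  have h3 := fun j => mul_le_mul_of_nonneg_left (normSq_le_gradSq (DA_subset_V (hu j))) hν.le
  simp only [Fin.sum_univ_two]
  linarith [h2 0, h2 1, h3 0, h3 1]

theorem enstrophy_rate (hu : ∀ j, u j ∈ DA) :
    ∑ j, 2 * inner ℝ (stokes (u j)) (nudgedRhs ν μ₁ μ₂ N f u j)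
      = ∑ j, 2 * inner ℝ (f j) (stokes (u j)) - 2 * (μ₁ * gradSq (lowPass N (u 0))
        + μ₁ * gradSq (lowPass N (u 1)) - 2 * (μ₂ * ∑ i, inner ℝ (pd i (lowPass N (u 0)))
          (pd i (lowPass N (u 1))))) - 2 * ν * ∑ j, ‖stokes (u j)‖ ^ 2 := by
  have h0 := inner_bilin_stokes (hu 0)
  have h1 := inner_bilin_stokes (hu 1)
  have hV := fun j => DA_subset_V (hu j)
  have e : ∑ i, inner ℝ (pd i (lowPass N (u 1))) (pd i (lowPass N (u 0)))
      = ∑ i, inner ℝ (pd i (lowPass N (u 0))) (pd i (lowPass N (u 1))) :=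
    Finset.sum_congr rfl fun i _ => real_inner_comm _ _
  have es : ∀ j, ∑ i, ‖pd i (lowPass N (u j))‖ ^ 2 = gradSq (lowPass N (u j)) := fun _ => rfl
  rw [Fin.sum_univ_two, Fin.sum_univ_two, Fin.sum_univ_two (fun j => ‖stokes (u j)‖ ^ 2)]
  rw [nudgedRhs_zero, nudgedRhs_one, real_inner_comm, real_inner_comm _ (stokes (u 1))]
  simp only [inner_sub_left, inner_add_left, inner_smul_left_H, h0, h1,
    inner_lowPass_stokes N (hV 0) (hu 0), inner_lowPass_stokes N (hV 0) (hu 1),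
    inner_lowPass_stokes N (hV 1) (hu 0), inner_lowPass_stokes N (hV 1) (hu 1), e, es,
    real_inner_self_eq_norm_sq]
  ring

theorem two_mul_abs_grad_inner_le (a b : H) :
    2 * |∑ i, inner ℝ (pd i a) (pd i b)| ≤ gradSq a + gradSq b := by
  refine le_trans ?_ (inner_sum_le_norm_sq (s := Finset.univ) (fun i => pd i a) fun i => pd i b)
  rw [← Finset.mul_sum]
  exact mul_le_mul_of_nonneg_left (Finset.abs_sum_le_sum_abs _ _) zero_le_two

theorem enstrophy_rate_le (hν : 0 < ν) (hμ : |μ₂| ≤ μ₁) (hu : ∀ j, u j ∈ DA) :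
    ∑ j, 2 * inner ℝ (stokes (u j)) (nudgedRhs ν μ₁ μ₂ N f u j)
      ≤ -(ν * ∑ j, ‖stokes (u j)‖ ^ 2) + 1 / ν * ∑ j, ‖f j‖ ^ 2 := by
  rw [enstrophy_rate hu]
  have h1 := coupling_nonneg hμ
    (two_mul_abs_grad_inner_le (lowPass N (u 0)) (lowPass N (u 1)))
  have h2 := fun j => two_mul_inner_le hν (f j) (stokes (u j))
  rw [Fin.sum_univ_two, Fin.sum_univ_two (fun j => ‖stokes (u j)‖ ^ 2),
    Fin.sum_univ_two (fun j => ‖f j‖ ^ 2)]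
  linarith [h2 0, h2 1]

/-- Let δ = μ₁-μ₂. The remainder f - δf' is paired with Au at the cost of ν|Au|²; the part δf' is
paired as δ(∇f',∇u), at the cost of δ‖u‖². The coupling yields -2δ‖P_N u‖², and the unused ν|Au|²
completes it to -2δ‖u‖². -/
theorem enstrophy_rate_le_of_shift (hν : 0 < ν) (hN : 0 < N) (hμ₂ : 0 ≤ μ₂) (hμ : μ₂ < μ₁)
    (hle : μ₁ + μ₂ ≤ 1 / 4 * N ^ 2 * ν) (hu : ∀ j, u j ∈ DA) {f' : Fin 2 → H}
    (hf' : ∀ j, f' j ∈ V) :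
    ∑ j, 2 * inner ℝ (stokes (u j)) (nudgedRhs ν μ₁ μ₂ N f u j)
      ≤ -((μ₁ - μ₂) * ∑ j, gradSq (u j))
        + (1 / ν * ∑ j, ‖f j - (μ₁ - μ₂) • f' j‖ ^ 2 + (μ₁ - μ₂) * ∑ j, gradSq (f' j)) := by
  rw [enstrophy_rate hu]
  have h1 := coupling_coercive (μ₁ := μ₁) hμ₂
    (two_mul_abs_grad_inner_le (lowPass N (u 0)) (lowPass N (u 1)))
  have h2 := fun j => two_mul_inner_le hν (f j - (μ₁ - μ₂) • f' j) (stokes (u j))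
  have hδ : 0 < μ₁ - μ₂ := sub_pos.2 hμ
  have h3 : ∀ j, 2 * ((μ₁ - μ₂) * inner ℝ (f' j) (stokes (u j)))
      ≤ (μ₁ - μ₂) * gradSq (f' j) + (μ₁ - μ₂) * gradSq (u j) := by
    intro j
    rw [real_inner_comm, inner_stokes_left (hu j) (hf' j)]
    have h4 := two_mul_abs_grad_inner_le (u j) (f' j)
    have h5 := le_abs_self (∑ i, inner ℝ (pd i (u j)) (pd i (f' j)))
    have h6 := mul_le_mul_of_nonneg_left (show 2 * (∑ i, inner ℝ (pd i (u j)) (pd i (f' j)))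
      ≤ gradSq (u j) + gradSq (f' j) by linarith) hδ.le
    linarith
  -- High modes: μ₁-μ₂ ≤ μ₁+μ₂ ≤ N²ν/4, so viscosity there exceeds the damping that the coupling
  -- fails to provide.
  have h7 : ∀ j, 2 * (μ₁ - μ₂) * (gradSq (u j) - gradSq (lowPass N (u j)))
      ≤ ν * ‖stokes (u j)‖ ^ 2 := by
    intro j
    have h8 := spectral_gap_stokes hN.le (hu j)
    have h9 : 0 ≤ ν * ‖stokes (u j)‖ ^ 2 := by positivity
    rcases le_total (gradSq (u j) - gradSq (lowPass N (u j))) 0 with h | h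
    · have := mul_nonpos_of_nonneg_of_nonpos (show 0 ≤ 2 * (μ₁ - μ₂) by linarith) h
      linarith
    · have h10 : μ₁ - μ₂ ≤ 1 / 4 * N ^ 2 * ν := by linarith
      have h11 := mul_le_mul_of_nonneg_right h10 h
      have h12 := mul_le_mul_of_nonneg_left h8 hν.le
      linarith
  simp only [inner_sub_left, inner_smul_left_H] at h2
  rw [Fin.sum_univ_two, Fin.sum_univ_two (fun j => ‖stokes (u j)‖ ^ 2),
    Fin.sum_univ_two (fun j => ‖f j - (μ₁ - μ₂) • f' j‖ ^ 2), Fin.sum_univ_two (fun j =>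
      gradSq (u j)), Fin.sum_univ_two (fun j => gradSq (f' j))]
  linarith [h2 0, h2 1, h3 0, h3 1, h7 0, h7 1]

/-- The cut-off L of the observed modes is independent of the N in the coupling, and θ is left open
so that different trilinear bounds can be inserted. The parameter η pays for the difference of the
forces. -/
theorem difference_rate_le (hν : 0 < ν) (hμ : |μ₂| ≤ μ₁) {L : ℝ} (hL : 0 < L)
    (hu : ∀ j, u j ∈ DA) {θ η : ℝ} (hη : 0 < η)
    (hθ : |inner ℝ (bilin (u 0 - u 1) (u 0)) (u 0 - u 1)|
      ≤ θ * (Real.sqrt (gradSq (u 0 - u 1)) * ‖u 0 - u 1‖)) :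
    2 * inner ℝ (u 0 - u 1) (nudgedRhs ν μ₁ μ₂ N f u 0 - nudgedRhs ν μ₁ μ₂ N f u 1)
      ≤ -((ν * L ^ 2 - η - θ ^ 2 / ν) * ‖u 0 - u 1‖ ^ 2)
        + (1 / η * ‖f 0 - f 1‖ ^ 2 + ν * L ^ 2 * ‖lowPass L (u 0) - lowPass L (u 1)‖ ^ 2) := by
  set w := u 0 - u 1 with hw
  have hwA : w ∈ DA := sub_mem_DA (hu 0) (hu 1)
  have hR : nudgedRhs ν μ₁ μ₂ N f u 0 - nudgedRhs ν μ₁ μ₂ N f u 1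
      = (f 0 - f 1) - (μ₁ + μ₂) • lowPass N w - ν • stokes w
        - (bilin (u 0) (u 0) - bilin (u 1) (u 1)) := by
    rw [nudgedRhs_zero, nudgedRhs_one, hw, lowPass_sub, stokes_sub (hu 0) (hu 1)]
    module
  rw [hR, real_inner_comm]
  simp only [inner_sub_left (𝕜 := ℝ) _ _ w, inner_smul_left_H]
  rw [← inner_sub_left (bilin (u 0) (u 0)), ← inner_sub_left (f 0), hw,
    inner_bilin_sub (hu 0) (hu 1), ← hw, inner_stokes_self hwA, inner_lowPass_left,
    real_inner_self_eq_norm_sq, ← lowPass_sub, ← hw]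
  have h1 := two_mul_inner_le hη (f 0 - f 1) w
  have h2 : 0 ≤ (μ₁ + μ₂) * ‖lowPass N w‖ ^ 2 :=
    mul_nonneg (by linarith [(abs_le.1 hμ).1]) (sq_nonneg _)
  have h3 := mul_le_mul_of_nonneg_left (spectral_gap hL.le (DA_subset_V hwA)) hν.le
  have h4 : 2 * (θ * (Real.sqrt (gradSq w) * ‖w‖)) ≤ ν * gradSq w + θ ^ 2 / ν * ‖w‖ ^ 2 := by
    have hs := Real.sq_sqrt (gradSq_nonneg w)
    have h5 : ν * Real.sqrt (gradSq w) ^ 2 + θ ^ 2 / ν * ‖w‖ ^ 2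
        - 2 * (θ * (Real.sqrt (gradSq w) * ‖w‖))
        = 1 / ν * (ν * Real.sqrt (gradSq w) - θ * ‖w‖) ^ 2 := by
      field_simp; ring
    have h6 : 0 ≤ 1 / ν * (ν * Real.sqrt (gradSq w) - θ * ‖w‖) ^ 2 := by positivity
    rw [hs] at h5
    linarith
  have h7 := neg_abs_le (inner ℝ (bilin w (u 0)) w)
  linarith

end Estimates

/-! ### Time averages along solutions and synchronization. -/

section Synchronization

open Set

variable {ν μ₁ μ₂ N : ℝ}

theorem norm_nudgedRhs_le (hν : 0 < ν) {f u : Fin 2 → H} {C : ℝ} (hf : ∀ j, ‖f j‖ ≤ C)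
    (hu : ∀ j, ‖u j‖ ≤ C) (j : Fin 2) (hj : u j ∈ DA) (hD : Real.sqrt (gradSq (u j)) ≤ C) :
    ‖nudgedRhs ν μ₁ μ₂ N f u j‖
      ≤ (1 + ∑ l, |nudgingMatrix μ₁ μ₂ j l|) * C + (ν + supConst * C) * ‖stokes (u j)‖ := by
  unfold nudgedRhs
  have h1 : ‖∑ l, nudgingMatrix μ₁ μ₂ j l • nudgingFunction N l (u l)‖
      ≤ ∑ l, |nudgingMatrix μ₁ μ₂ j l| * C := by
    refine (norm_sum_le _ _).trans (Finset.sum_le_sum fun l _ => ?_)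
    rw [norm_smul, Real.norm_eq_abs]
    refine mul_le_mul_of_nonneg_left ?_ (abs_nonneg _)
    rw [nudgingFunction, norm_neg]
    exact (norm_lowPass_le N _).trans (hu l)
  have h2 : ‖ν • stokes (u j)‖ = ν * ‖stokes (u j)‖ := by
    rw [norm_smul, Real.norm_of_nonneg hν.le]
  have h3 := norm_bilin_le hj (u j)
  have h4 := mul_le_mul_of_nonneg_left hD (mul_nonneg supConst_pos.le (norm_nonneg (stokes (u j))))
  have h5 := norm_sub_le (f j + ∑ l, nudgingMatrix μ₁ μ₂ j l • nudgingFunction N l (u l)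
    - ν • stokes (u j)) (bilin (u j) (u j))
  have h6 := norm_sub_le (f j + ∑ l, nudgingMatrix μ₁ μ₂ j l • nudgingFunction N l (u l))
    (ν • stokes (u j))
  have h7 := norm_add_le (f j) (∑ l, nudgingMatrix μ₁ μ₂ j l • nudgingFunction N l (u l))
  rw [← Finset.sum_mul] at h1
  linarith [hf j]

variable {g v : Fin 2 → ℝ → H}

/-- The right-hand side of the equations along a pair of trajectories. -/
noncomputable def rate (ν μ₁ μ₂ N : ℝ) (g v : Fin 2 → ℝ → H) (j : Fin 2) (t : ℝ) : H :=
  nudgedRhs ν μ₁ μ₂ N (fun i => g i t) (fun i => v i t) j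

abbrev IsNudgedSolution (ν μ₁ μ₂ N : ℝ) (g v : Fin 2 → ℝ → H) : Prop :=
  IsIntertwinedSolution ν (nudgingMatrix μ₁ μ₂) (nudgingFunction N) g v

theorem isPrimitiveOf_rate (hs : IsNudgedSolution ν μ₁ μ₂ N g v) (j : Fin 2) :
    IsPrimitiveOf (v j) (rate ν μ₁ μ₂ N g v j) := fun t ht =>
  ⟨hs.intervalIntegrable j t ht, hs.equation j t ht⟩

theorem continuousOn_gradSq_solution (hs : IsNudgedSolution ν μ₁ μ₂ N g v) (j : Fin 2) :
    ContinuousOn (fun t => gradSq (v j t)) (Ici 0) :=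
  continuousOn_gradSq (hs.mem_V j) (hs.continuous_V j)

theorem intervalIntegrable_gradSq (hs : IsNudgedSolution ν μ₁ μ₂ N g v) (j : Fin 2) (t : ℝ)
    (ht : 0 ≤ t) : IntervalIntegrable (fun t => gradSq (v j t)) volume 0 t := by
  refine ((continuousOn_gradSq_solution hs j).mono ?_).intervalIntegrable
  rw [uIcc_of_le ht]
  exact Icc_subset_Ici_self

theorem intervalIntegrable_sq_norm_stokes (hs : IsNudgedSolution ν μ₁ μ₂ N g v) (j : Fin 2)
    (t : ℝ) (ht : 0 ≤ t) : IntervalIntegrable (fun t => ‖stokes (v j t)‖ ^ 2) volume 0 t := by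
  rw [intervalIntegrable_iff]
  exact (memLp_uIoc (hs.memLp_stokes j) ht).integrable_norm_pow two_ne_zero

theorem ae_mem_DA (hs : IsNudgedSolution ν μ₁ μ₂ N g v) :
    ∀ᵐ t ∂timeMeasure, ∀ j, v j t ∈ DA := ae_all_iff.2 hs.mem_DA

theorem exists_bound_on (hs : IsNudgedSolution ν μ₁ μ₂ N g v) (T : ℝ) :
    ∃ C, 0 ≤ C ∧ ∀ t ∈ Icc 0 T, ∀ j, Real.sqrt (gradSq (v j t)) ≤ C := by
  have h : ContinuousOn (fun t => ∑ j, Real.sqrt (gradSq (v j t))) (Icc 0 T) :=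
    continuousOn_finsetSum _ fun j _ =>
      Real.continuous_sqrt.comp_continuousOn
        ((continuousOn_gradSq_solution hs j).mono Icc_subset_Ici_self)
  obtain ⟨C, hC⟩ := isCompact_Icc.exists_bound_of_continuousOn h
  refine ⟨|C|, abs_nonneg _, fun t ht j => ?_⟩
  refine le_trans ?_ ((le_abs_self _).trans ((hC t ht).trans (le_abs_self _)))
  exact Finset.single_le_sum (f := fun j => Real.sqrt (gradSq (v j t)))
    (fun _ _ => Real.sqrt_nonneg _) (Finset.mem_univ j)

theorem norm_le_sqrt_gradSq {u : H} (hu : u ∈ V) : ‖u‖ ≤ Real.sqrt (gradSq u) :=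
  Real.le_sqrt_of_sq_le (normSq_le_gradSq hu)

/-- Continuity in V bounds ‖v‖ on [0,T], so the convective term is at most a constant times |Av|,
which is square integrable in time. The enstrophy identity needs this. -/
theorem memLp_rate (hν : 0 < ν) (hg : ∀ j, IsForce (g j))
    (hs : IsNudgedSolution ν μ₁ μ₂ N g v) (j : Fin 2) (T : ℝ) (hT : 0 < T) :
    MemLp (rate ν μ₁ μ₂ N g v j) 2 (volume.restrict (Ioo 0 T)) := by
  obtain ⟨C, hC0, hC⟩ := exists_bound_on hs T
  choose D hD0 hD using fun j => exists_ae_norm_le (hg j)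
  obtain ⟨B, hCB, hDB⟩ : ∃ B, C ≤ B ∧ ∀ i, D i ≤ B := by
    refine ⟨C + ∑ i, D i, ?_, fun i => ?_⟩
    · linarith [Finset.sum_nonneg fun i (_ : i ∈ Finset.univ) => hD0 i]
    · linarith [Finset.single_le_sum (fun i _ => hD0 i) (Finset.mem_univ i)]
  obtain ⟨a, b, hab⟩ : ∃ a b : ℝ, ∀ f u : Fin 2 → H, (∀ j, ‖f j‖ ≤ B) → (∀ j, ‖u j‖ ≤ B) →
      u j ∈ DA → Real.sqrt (gradSq (u j)) ≤ B →
      ‖nudgedRhs ν μ₁ μ₂ N f u j‖ ≤ a + b * ‖stokes (u j)‖ :=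
    ⟨_, _, fun f u hf hu hj hDj => norm_nudgedRhs_le hν hf hu j hj hDj⟩
  have hbound : MemLp (fun t => a + b * ‖stokes (v j t)‖) 2 (volume.restrict (Ioo 0 T)) :=
    MemLp.add (f := fun _ => a) (memLp_const a) ((hs.memLp_stokes j T hT).norm.const_mul b)
  refine hbound.mono' ?_ ?_
  · have h := (isPrimitiveOf_rate hs j T hT.le).1
    rw [intervalIntegrable_iff, uIoc_of_le hT.le] at h
    exact (h.mono_set Ioo_subset_Ioc_self).aestronglyMeasurable
  · have h1 := (ae_restrict_iff' measurableSet_Ioi).1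
      ((ae_mem_DA hs).and (ae_all_iff.2 hD))
    rw [ae_restrict_iff' measurableSet_Ioo]
    filter_upwards [h1] with t ht htT
    obtain ⟨hDA, hgt⟩ := ht htT.1
    have hCt := hC t ⟨htT.1.le, htT.2.le⟩
    exact hab (fun i => g i t) (fun i => v i t) (fun i => (hgt i).trans (hDB i))
      (fun i => (norm_le_sqrt_gradSq (DA_subset_V (hDA i))).trans ((hCt i).trans hCB)) (hDA j)
      ((hCt j).trans hCB)

theorem isPrimitiveOf_energy (hs : IsNudgedSolution ν μ₁ μ₂ N g v) :
    IsPrimitiveOf (fun t => ∑ j, ‖v j t‖ ^ 2)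
      (fun t => ∑ j, 2 * inner ℝ (v j t) (rate ν μ₁ μ₂ N g v j t)) :=
  IsPrimitiveOf.sum fun j _ => (isPrimitiveOf_rate hs j).normSq

theorem isPrimitiveOf_enstrophy (hν : 0 < ν) (hg : ∀ j, IsForce (g j))
    (hs : IsNudgedSolution ν μ₁ μ₂ N g v) :
    IsPrimitiveOf (fun t => ∑ j, gradSq (v j t))
      (fun t => ∑ j, 2 * inner ℝ (stokes (v j t)) (rate ν μ₁ μ₂ N g v j t)) :=
  IsPrimitiveOf.sum fun j _ => (isPrimitiveOf_rate hs j).gradSq (hs.mem_V j) (hs.mem_DA j)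
    (hs.memLp_stokes j) (memLp_rate hν hg hs j)

/-- Since φ ≤ D, the same inequality first bounds φ(s) uniformly in s; integrating from s then gives
a mean d/c with an additive constant independent of s. -/
theorem IsPrimitiveOf.integral_le_linear {φ Φ D : ℝ → ℝ} (h : IsPrimitiveOf φ Φ)
    (h0 : ∀ t, 0 ≤ t → 0 ≤ φ t) (hD : ∀ t, 0 ≤ t → IntervalIntegrable D volume 0 t) {c d : ℝ}
    (hc : 0 < c) (hd : 0 ≤ d) (hφ : ∀ᵐ s ∂timeMeasure, φ s ≤ D s)
    (hle : ∀ᵐ s ∂timeMeasure, Φ s ≤ -(c * D s) + d) {s t : ℝ} (hs : 0 ≤ s) (hst : s ≤ t) :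
    ∫ r in s..t, D r ≤ d / c * (t - s) + (φ 0 + d / c) / c := by
  have h1 := h.integral_le h0 (fun t ht => (hD t ht).const_mul c) hle hs hst
  rw [intervalIntegral.integral_const_mul] at h1
  have h2 : φ s ≤ φ 0 + d / c := by
    refine h.le_add_of_le h0 hc hd ?_ hs
    filter_upwards [hφ, hle] with r h3 h4
    have := mul_le_mul_of_nonneg_left h3 hc.le
    linarith
  rw [← mul_le_mul_iff_right₀ hc]
  refine (h1.trans (add_le_add_left h2 _)).trans (le_of_eq ?_)
  field_simp
  ring

theorem synchronizes_of_integral_le (hν : 0 < ν) (hμ : |μ₂| ≤ μ₁)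
    (hs : IsNudgedSolution ν μ₁ μ₂ N g v) {L : ℝ} (hL : 0 < L) {θ : ℝ → ℝ}
    (hθ : ∀ᵐ t ∂timeMeasure, |inner ℝ (bilin (v 0 t - v 1 t) (v 0 t)) (v 0 t - v 1 t)|
      ≤ θ t * (Real.sqrt (gradSq (v 0 t - v 1 t)) * ‖v 0 t - v 1 t‖))
    (hint : ∀ t, 0 ≤ t → IntervalIntegrable (fun t => θ t ^ 2) volume 0 t) {κ K : ℝ}
    (hκ : κ < ν ^ 2 * L ^ 2)
    (hK : ∀ s t, 0 ≤ s → s ≤ t → ∫ r in s..t, θ r ^ 2 ≤ κ * (t - s) + K)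
    (hlow : LowModesSynchronize L v) (hforce : ForcesSynchronize g) : Synchronizes v := by
  -- Half of the spectral surplus. It serves both as η and as the mean decay rate: νL² - a - κ/ν =
  -- a.
  set a := (ν * L ^ 2 - κ / ν) / 2 with ha
  have ha0 : 0 < a := by
    have : κ / ν < ν * L ^ 2 := by
      rw [div_lt_iff₀ hν]; linarith
    rw [ha]; linarith
  have hpi : 0 < 2 * Real.pi := by positivity
  have hp := ((isPrimitiveOf_rate hs 0).sub (isPrimitiveOf_rate hs 1)).normSq
  have hβ : Tendsto (fun t => 1 / a * ‖g 0 t - g 1 t‖ ^ 2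
      + ν * L ^ 2 * ‖lowPass L (v 0 t) - lowPass L (v 1 t)‖ ^ 2) (atTop ⊓ ae volume) (𝓝 0) := by
    have h1 : Tendsto (fun t => ‖g 0 t - g 1 t‖) (atTop ⊓ ae volume) (𝓝 0) := by
      have := Tendsto.const_mul (2 * Real.pi)⁻¹ hforce
      simpa only [hNorm_eq, inv_mul_cancel_left₀ hpi.ne', mul_zero] using this
    have h2 : Tendsto (fun t => ‖lowPass L (v 0 t) - lowPass L (v 1 t)‖) (atTop ⊓ ae volume)
        (𝓝 0) := by
      have := (Tendsto.const_mul (2 * Real.pi)⁻¹ hlow).mono_left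
        (inf_le_left : atTop ⊓ ae (volume : Measure ℝ) ≤ atTop)
      simpa only [hNorm_eq, inv_mul_cancel_left₀ hpi.ne', mul_zero] using this
    have h3 := ((h1.pow 2).const_mul (1 / a)).add ((h2.pow 2).const_mul (ν * L ^ 2))
    simpa using h3
  have hlim := hp.tendsto_zero (α := fun t => ν * L ^ 2 - a - θ t ^ 2 / ν)
    (β := fun t => 1 / a * ‖g 0 t - g 1 t‖ ^ 2
      + ν * L ^ 2 * ‖lowPass L (v 0 t) - lowPass L (v 1 t)‖ ^ 2) (a := a) (K := K / ν)
    (fun t _ => sq_nonneg _)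
    (fun t ht => _root_.intervalIntegrable_const.sub ((hint t ht).div_const ν)) ha0 ?_ ?_ ?_
  · have h1 := hlim.sqrt.const_mul (2 * Real.pi)
    rw [Real.sqrt_zero, mul_zero] at h1
    refine h1.congr fun t => ?_
    rw [Real.sqrt_sq (norm_nonneg _), hNorm_eq]
  · intro s t hs0 hst
    have hi := intervalIntegrable_of_zero hint hs0 (hs0.trans hst)
    have e : (∫ r in s..t, (ν * L ^ 2 - a - θ r ^ 2 / ν))
        = (ν * L ^ 2 - a) * (t - s) - (∫ r in s..t, θ r ^ 2) / ν := by
      rw [intervalIntegral.integral_sub _root_.intervalIntegrable_const (hi.div_const ν),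
        intervalIntegral.integral_const, intervalIntegral.integral_div, smul_eq_mul]
      ring
    rw [e]
    have h1 := div_le_div_of_nonneg_right (hK s t hs0 hst) hν.le
    have h2 : (κ * (t - s) + K) / ν = κ / ν * (t - s) + K / ν := by ring
    have h3 : a * (t - s) = (ν * L ^ 2 - a) * (t - s) - κ / ν * (t - s) := by rw [ha]; ring
    linarith
  · filter_upwards [ae_mem_DA hs, hθ] with t hDA ht
    exact difference_rate_le hν hμ hL hDA ha0 ht
  · intro ε hε
    have h1 := (hβ.eventually_lt_const hε)
    -- Smallness holds on the intersection of a late half-line with a set of full measure.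
    rw [eventually_inf] at h1
    obtain ⟨S, hS, S', hS', h2⟩ := h1
    obtain ⟨T, hT⟩ := mem_atTop_sets.1 hS
    refine ⟨max T 0, le_max_right _ _, ?_⟩
    filter_upwards [ae_restrict_of_ae hS'] with t ht htT
    exact le_of_lt (h2 t ⟨hT t ((le_max_left _ _).trans htT), ht⟩)

theorem intervalIntegrable_sum_gradSq (hs : IsNudgedSolution ν μ₁ μ₂ N g v) (t : ℝ)
    (ht : 0 ≤ t) : IntervalIntegrable (fun t => ∑ j, gradSq (v j t)) volume 0 t := by
  simpa only [Finset.sum_fn] using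
    IntervalIntegrable.sum Finset.univ fun j _ => intervalIntegrable_gradSq hs j t ht

theorem gradSq_le_sum (u : Fin 2 → H) (i : Fin 2) : gradSq (u i) ≤ ∑ j, gradSq (u j) :=
  Finset.single_le_sum (f := fun j => gradSq (u j)) (fun _ _ => gradSq_nonneg _)
    (Finset.mem_univ i)

theorem synchronizes_of_integral_gradSq_le (hν : 0 < ν) (hμ : |μ₂| ≤ μ₁)
    (hs : IsNudgedSolution ν μ₁ μ₂ N g v) {L : ℝ} (hL : 0 < L) {C : ℝ}
    (hC : IsLadyzhenskayaConstant C) {c K : ℝ}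
    (hc : (2 * Real.pi) ^ 2 * C ^ 2 * c < ν ^ 2 * L ^ 2)
    (hK : ∀ s t, 0 ≤ s → s ≤ t → ∫ r in s..t, ∑ j, gradSq (v j r) ≤ c * (t - s) + K)
    (hlow : LowModesSynchronize L v) (hforce : ForcesSynchronize g) : Synchronizes v := by
  have hsq : ∀ t, (C * vNorm (v 0 t)) ^ 2 = (2 * Real.pi) ^ 2 * C ^ 2 * gradSq (v 0 t) := by
    intro t
    rw [vNorm_eq, mul_pow, mul_pow, Real.sq_sqrt (gradSq_nonneg _)]
    ring
  have hi : ∀ t, 0 ≤ t → IntervalIntegrable (fun t => (C * vNorm (v 0 t)) ^ 2) volume 0 t := by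
    intro t ht
    simp_rw [hsq]
    exact (intervalIntegrable_gradSq hs 0 t ht).const_mul _
  refine synchronizes_of_integral_le hν hμ hs hL (θ := fun t => C * vNorm (v 0 t))
    (K := (2 * Real.pi) ^ 2 * C ^ 2 * K) ?_ hi hc (fun s t hs0 hst => ?_) hlow hforce
  · filter_upwards [ae_mem_DA hs] with t ht
    exact abs_inner_bilin_le_ladyzhenskaya hC (sub_mem_DA (ht 0) (ht 1)) (v 0 t)
  · simp_rw [hsq]
    rw [intervalIntegral.integral_const_mul]
    have ht := hs0.trans hst
    have h1 : (∫ r in s..t, gradSq (v 0 r)) ≤ ∫ r in s..t, ∑ j, gradSq (v j r) :=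
      intervalIntegral.integral_mono_on hst
        (intervalIntegrable_of_zero (intervalIntegrable_gradSq hs 0) hs0 ht)
        (intervalIntegrable_of_zero (intervalIntegrable_sum_gradSq hs) hs0 ht)
        fun r _ => gradSq_le_sum (fun j => v j r) 0
    have h2 := mul_le_mul_of_nonneg_left (h1.trans (hK s t hs0 hst))
      (show 0 ≤ (2 * Real.pi) ^ 2 * C ^ 2 by positivity)
    linarith

theorem ae_sum_sq_norm_le {g : Fin 2 → ℝ → H} (hg : ∀ j, IsForce (g j)) :
    ∀ᵐ t ∂timeMeasure, (2 * Real.pi) ^ 2 * ∑ j, ‖g j t‖ ^ 2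
      ≤ ∑ j, timeSup (fun t => hNorm (g j t)) ^ 2 := by
  have h : ∀ j, ∀ᵐ t ∂timeMeasure, hNorm (g j t) ≤ timeSup fun t => hNorm (g j t) := by
    intro j
    obtain ⟨C, hC0, hC⟩ := exists_ae_norm_le (hg j)
    refine ae_le_timeSup (C := 2 * Real.pi * C) ?_
    filter_upwards [hC] with t ht
    rw [hNorm_eq, abs_of_nonneg (by positivity)]
    exact mul_le_mul_of_nonneg_left ht (by positivity)
  filter_upwards [ae_all_iff.2 h] with t ht
  rw [Finset.mul_sum]
  refine Finset.sum_le_sum fun j _ => ?_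
  rw [← mul_pow]
  have h0 : 0 ≤ 2 * Real.pi * ‖g j t‖ := by positivity
  exact pow_le_pow_left₀ h0 (ht j) 2

theorem sq_grashof (hν : 0 < ν) (g : Fin 2 → ℝ → H) :
    ν ^ 4 * grashof ν g ^ 2 = ∑ j, timeSup (fun t => hNorm (g j t)) ^ 2 := by
  rw [grashof, Real.sq_sqrt (Finset.sum_nonneg fun _ _ => sq_nonneg _), Finset.mul_sum]
  refine Finset.sum_congr rfl fun j _ => ?_
  field_simp

theorem sq_shiftNumber (hν : 0 < ν) (g : Fin 2 → ℝ → H) :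
    ν ^ 2 * shiftNumber ν g ^ 2 = ∑ j, timeSup (fun t => vNorm (g j t)) ^ 2 := by
  rw [shiftNumber, Real.sq_sqrt (Finset.sum_nonneg fun _ _ => sq_nonneg _), Finset.mul_sum]
  refine Finset.sum_congr rfl fun j _ => ?_
  field_simp

theorem ae_pair_sq_norm_le (hν : 0 < ν) {G : Fin 2 → ℝ → H} (hG : ∀ j, IsForce (G j)) :
    ∀ᵐ t ∂timeMeasure, (2 * Real.pi) ^ 2 * ∑ j, ‖G j t‖ ^ 2 ≤ ν ^ 4 * pairGrashof ν G ^ 2 := by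
  have he : ν ^ 4 * pairGrashof ν G ^ 2
      = timeSup (fun t => Real.sqrt (∑ j, hNorm (G j t) ^ 2)) ^ 2 := by
    rw [pairGrashof]; field_simp
  have hsum : ∀ t, ∑ j, hNorm (G j t) ^ 2 = (2 * Real.pi) ^ 2 * ∑ j, ‖G j t‖ ^ 2 := by
    intro t
    rw [Finset.mul_sum]
    exact Finset.sum_congr rfl fun j _ => by rw [hNorm_eq, mul_pow]
  -- Finiteness of the supremum of the pair, obtained from the separate suprema.
  have hb : ∀ᵐ t ∂timeMeasure, |Real.sqrt (∑ j, hNorm (G j t) ^ 2)|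
      ≤ Real.sqrt (∑ j, timeSup (fun t => hNorm (G j t)) ^ 2) := by
    filter_upwards [ae_sum_sq_norm_le hG] with t ht
    rw [abs_of_nonneg (Real.sqrt_nonneg _), hsum]
    exact Real.sqrt_le_sqrt ht
  filter_upwards [ae_le_timeSup hb] with t ht
  rw [he, ← hsum, ← Real.sq_sqrt (Finset.sum_nonneg fun _ _ => sq_nonneg _)]
  exact pow_le_pow_left₀ (Real.sqrt_nonneg _) ht 2

theorem ae_sum_gradSq_le (hν : 0 < ν) {g : Fin 2 → ℝ → H} (hg : ∀ j, IsRegularForce (g j)) :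
    ∀ᵐ t ∂timeMeasure, (2 * Real.pi) ^ 2 * ∑ j, gradSq (g j t)
      ≤ ν ^ 2 * shiftNumber ν g ^ 2 := by
  have h : ∀ j, ∀ᵐ t ∂timeMeasure, vNorm (g j t) ≤ timeSup fun t => vNorm (g j t) := by
    intro j
    choose C hC0 hC using fun i => exists_ae_norm_le ((hg j).2.2 i)
    refine ae_le_timeSup (C := 2 * Real.pi * Real.sqrt (∑ i, C i ^ 2)) ?_
    filter_upwards [ae_all_iff.2 hC] with t ht
    rw [vNorm_eq, abs_of_nonneg (by positivity)]
    refine mul_le_mul_of_nonneg_left (Real.sqrt_le_sqrt ?_) (by positivity)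
    exact Finset.sum_le_sum fun i _ => pow_le_pow_left₀ (norm_nonneg _) (ht i) 2
  filter_upwards [ae_all_iff.2 h] with t ht
  rw [sq_shiftNumber hν, Finset.mul_sum]
  refine Finset.sum_le_sum fun j _ => ?_
  have h1 := pow_le_pow_left₀ (by rw [vNorm_eq]; positivity) (ht j) 2
  rwa [vNorm_eq, mul_pow, Real.sq_sqrt (gradSq_nonneg _)] at h1

theorem ae_normSq_le_gradSq (hs : IsNudgedSolution ν μ₁ μ₂ N g v) :
    ∀ᵐ t ∂timeMeasure, ∑ j, ‖v j t‖ ^ 2 ≤ ∑ j, gradSq (v j t) := by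
  filter_upwards [ae_mem_DA hs] with t ht
  exact Finset.sum_le_sum fun j _ => normSq_le_gradSq (DA_subset_V (ht j))

theorem synchronizes_of_grashof_le (hν : 0 < ν) (hN : 0 < N) (hμ : |μ₂| ≤ μ₁) {C : ℝ}
    (hC : IsLadyzhenskayaConstant C) (hg : ∀ j, IsForce (g j))
    (hle : 4 * C * grashof ν g ≤ N) (hs : IsNudgedSolution ν μ₁ μ₂ N g v)
    (hlow : LowModesSynchronize N v) (hforce : ForcesSynchronize g) : Synchronizes v := by
  have hpi : 0 < (2 * Real.pi) ^ 2 := by positivity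
  set G := ν ^ 4 * grashof ν g ^ 2 / (2 * Real.pi) ^ 2 with hG
  have hG0 : 0 ≤ G := by positivity
  have hrate : ∀ᵐ t ∂timeMeasure, ∑ j, 2 * inner ℝ (v j t) (rate ν μ₁ μ₂ N g v j t)
      ≤ -(ν * ∑ j, gradSq (v j t)) + 1 / ν * G := by
    filter_upwards [ae_mem_DA hs, ae_sum_sq_norm_le hg] with t hDA ht
    rw [← sq_grashof hν, ← le_div_iff₀' hpi] at ht
    have h1 := energy_rate_le (N := N) (f := fun i => g i t) hν hμ hDA
    have h2 := mul_le_mul_of_nonneg_left ht (show 0 ≤ 1 / ν by positivity)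
    exact h1.trans (by linarith)
  refine synchronizes_of_integral_gradSq_le hν hμ hs hN hC ?_ (fun s t hs0 hst =>
    (isPrimitiveOf_energy hs).integral_le_linear
      (fun t _ => Finset.sum_nonneg fun _ _ => sq_nonneg _) (intervalIntegrable_sum_gradSq hs) hν
      (by positivity) (ae_normSq_le_gradSq hs) hrate hs0 hst) hlow hforce
  have h1 : (2 * Real.pi) ^ 2 * C ^ 2 * (1 / ν * G / ν) = ν ^ 2 * (C * grashof ν g) ^ 2 := by
    rw [hG]; field_simp
  have h2 : 0 ≤ C * grashof ν g := mul_nonneg hC.1.le (Real.sqrt_nonneg _)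
  rw [h1]
  -- Only the strict inequality C · `grashof ν g` < N is needed here.
  refine mul_lt_mul_of_pos_left (pow_lt_pow_left₀ ?_ h2 two_ne_zero) (by positivity)
  linarith

theorem synchronizes_of_shift_le (hν : 0 < ν) (hN : 0 < N) (hμ₂ : 0 ≤ μ₂) (hμ : μ₂ < μ₁)
    (hμN : μ₁ + μ₂ ≤ 1 / 4 * N ^ 2 * ν) {C : ℝ} (hC : IsLadyzhenskayaConstant C)
    (hg : ∀ j, IsForce (g j)) {g' : Fin 2 → ℝ → H} (hg' : ∀ j, IsRegularForce (g' j))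
    (hle : 4 * C * Real.sqrt
      (ν / (μ₁ - μ₂) * pairGrashof ν (fun j t => g j t - (μ₁ - μ₂) • g' j t) ^ 2
        + shiftNumber ν g' ^ 2) ≤ N) (hs : IsNudgedSolution ν μ₁ μ₂ N g v)
    (hlow : LowModesSynchronize N v) (hforce : ForcesSynchronize g) : Synchronizes v := by
  have hpi : 0 < (2 * Real.pi) ^ 2 := by positivity
  have hδ : 0 < μ₁ - μ₂ := sub_pos.2 hμ
  have hμa : |μ₂| ≤ μ₁ := by rw [abs_of_nonneg hμ₂]; exact hμ.le
  set P := pairGrashof ν (fun j t => g j t - (μ₁ - μ₂) • g' j t) with hP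
  set S := shiftNumber ν g' with hS
  set d := 1 / ν * (ν ^ 4 * P ^ 2 / (2 * Real.pi) ^ 2)
    + (μ₁ - μ₂) * (ν ^ 2 * S ^ 2 / (2 * Real.pi) ^ 2) with hd
  have hG : ∀ j, IsForce fun t => g j t - (μ₁ - μ₂) • g' j t := fun j =>
    MemLp.sub (hg j) ((hg' j).1.const_smul (μ₁ - μ₂))
  have hrate : ∀ᵐ t ∂timeMeasure, ∑ j, 2 * inner ℝ (stokes (v j t)) (rate ν μ₁ μ₂ N g v j t)
      ≤ -((μ₁ - μ₂) * ∑ j, gradSq (v j t)) + d := by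
    filter_upwards [ae_mem_DA hs, ae_pair_sq_norm_le hν hG, ae_sum_gradSq_le hν hg',
      ae_all_iff.2 fun j => (hg' j).2.1] with t hDA h1 h2 hV
    rw [← le_div_iff₀' hpi] at h1 h2
    have h3 := enstrophy_rate_le_of_shift (f := fun i => g i t) hν hN hμ₂ hμ hμN hDA hV
    have h4 := mul_le_mul_of_nonneg_left h1 (show 0 ≤ 1 / ν by positivity)
    have h5 := mul_le_mul_of_nonneg_left h2 hδ.le
    exact h3.trans (by linarith)
  refine synchronizes_of_integral_gradSq_le hν hμa hs hN hC ?_ (fun s t hs0 hst =>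
    (isPrimitiveOf_enstrophy hν hg hs).integral_le_linear
      (fun t _ => Finset.sum_nonneg fun _ _ => gradSq_nonneg _)
      (intervalIntegrable_sum_gradSq hs) hδ (by positivity)
      (Eventually.of_forall fun _ => le_rfl) hrate hs0 hst) hlow hforce
  have h0 : 0 ≤ ν / (μ₁ - μ₂) * P ^ 2 + S ^ 2 := by positivity
  have h1 : (2 * Real.pi) ^ 2 * C ^ 2 * (d / (μ₁ - μ₂))
      = ν ^ 2 * (C * Real.sqrt (ν / (μ₁ - μ₂) * P ^ 2 + S ^ 2)) ^ 2 := by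
    rw [mul_pow C, Real.sq_sqrt h0, hd]
    have := hδ.ne'
    field_simp
  have h2 : 0 ≤ C * Real.sqrt (ν / (μ₁ - μ₂) * P ^ 2 + S ^ 2) :=
    mul_nonneg hC.1.le (Real.sqrt_nonneg _)
  rw [h1]
  refine mul_lt_mul_of_pos_left (pow_lt_pow_left₀ ?_ h2 two_ne_zero) (by positivity)
  linarith

theorem isFDAssistedSelfSynchronous_nudging (hν : 0 < ν) (hμ : |μ₂| ≤ μ₁) :
    IsFDAssistedSelfSynchronous ν (nudgingMatrix μ₁ μ₂) (nudgingFunction N) := by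
  intro g hg
  set G := ν ^ 4 * grashof ν g ^ 2 / (2 * Real.pi) ^ 2 with hG
  have hG0 : 0 ≤ G := by positivity
  have hpi : 0 < (2 * Real.pi) ^ 2 := by positivity
  -- The mean of θ² will be at most ν²x, and the cut-off 1 + x works because (1+x)² > x. It depends
  -- on ν and the forces only; the initial data enter through K alone.
  set x := supConst ^ 2 * (1 / ν * G / ν) / ν ^ 2 with hx
  have hx0 : 0 ≤ x := by positivity
  refine ⟨1 + x, by positivity, fun v hs hlow hforce => ?_⟩
  have hrate : ∀ᵐ t ∂timeMeasure, ∑ j, 2 * inner ℝ (stokes (v j t)) (rate ν μ₁ μ₂ N g v j t)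
      ≤ -(ν * ∑ j, ‖stokes (v j t)‖ ^ 2) + 1 / ν * G := by
    filter_upwards [ae_mem_DA hs, ae_sum_sq_norm_le hg] with t hDA ht
    rw [← sq_grashof hν, ← le_div_iff₀' hpi] at ht
    have h1 := enstrophy_rate_le (N := N) (f := fun i => g i t) hν hμ hDA
    have h2 := mul_le_mul_of_nonneg_left ht (show 0 ≤ 1 / ν by positivity)
    exact h1.trans (by linarith)
  have hA : ∀ᵐ t ∂timeMeasure, ∑ j, gradSq (v j t) ≤ ∑ j, ‖stokes (v j t)‖ ^ 2 := by
    filter_upwards [ae_mem_DA hs] with t ht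
    exact Finset.sum_le_sum fun j _ => gradSq_le_stokes (ht j)
  have hi : ∀ t, 0 ≤ t → IntervalIntegrable (fun t => ∑ j, ‖stokes (v j t)‖ ^ 2) volume 0 t := by
    intro t ht
    simpa only [Finset.sum_fn] using
      IntervalIntegrable.sum Finset.univ fun j _ => intervalIntegrable_sq_norm_stokes hs j t ht
  set K := (∑ j, gradSq (v j 0) + 1 / ν * G / ν) / ν
  have hK : ∀ s t, 0 ≤ s → s ≤ t → ∫ r in s..t, ∑ j, ‖stokes (v j r)‖ ^ 2
      ≤ 1 / ν * G / ν * (t - s) + K := fun s t hs0 hst =>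
    (isPrimitiveOf_enstrophy hν hg hs).integral_le_linear
      (fun t _ => Finset.sum_nonneg fun _ _ => gradSq_nonneg _) hi hν (by positivity) hA hrate
      hs0 hst
  have hi0 := intervalIntegrable_sq_norm_stokes hs 0
  refine synchronizes_of_integral_le hν hμ hs (show 0 < 1 + x by positivity)
    (θ := fun t => supConst * ‖stokes (v 0 t)‖) (κ := supConst ^ 2 * (1 / ν * G / ν))
    (K := supConst ^ 2 * K) ?_ (fun t ht => ?_) ?_ (fun s t hs0 hst => ?_) hlow hforce
  · filter_upwards [ae_mem_DA hs] with t ht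
    have hw := sub_mem_DA (ht 0) (ht 1)
    -- Antisymmetry moves the gradient onto w, so that v₁ can be estimated in the sup norm by |Av₁|.
    rw [inner_bilin_antisymm hw (DA_subset_V (ht 0)) (DA_subset_V hw), abs_neg]
    exact abs_inner_bilin_le_right hw (ht 0)
  · simp_rw [mul_pow]
    exact (hi0 t ht).const_mul _
  · have h1 : supConst ^ 2 * (1 / ν * G / ν) = ν ^ 2 * x := by
      rw [hx]; field_simp
    rw [h1]
    refine mul_lt_mul_of_pos_left ?_ (by positivity)
    linarith [sq_nonneg x, show (1 + x) ^ 2 = 1 + 2 * x + x ^ 2 by ring]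
  · simp_rw [mul_pow]
    rw [intervalIntegral.integral_const_mul]
    have ht := hs0.trans hst
    have h1 : (∫ r in s..t, ‖stokes (v 0 r)‖ ^ 2) ≤ ∫ r in s..t, ∑ j, ‖stokes (v j r)‖ ^ 2 :=
      intervalIntegral.integral_mono_on hst (intervalIntegrable_of_zero hi0 hs0 ht)
        (intervalIntegrable_of_zero hi hs0 ht) fun r _ =>
          Finset.single_le_sum (f := fun j => ‖stokes (v j r)‖ ^ 2) (fun _ _ => sq_nonneg _)
            (Finset.mem_univ 0)
    have h2 := mul_le_mul_of_nonneg_left (h1.trans (hK s t hs0 hst)) (sq_nonneg supConst)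
    linarith

end Synchronization

end PeriodicNSE

open PeriodicNSE
theorem mainTheorem7 (ν N μ₁ μ₂ : ℝ) (hν : 0 < ν) (hN : 0 < N)
    (hM : (nudgingMatrix μ₁ μ₂).PosSemidef) :
    IsFDAssistedSelfSynchronous ν (nudgingMatrix μ₁ μ₂) (nudgingFunction N) ∧
    ∀ C_L : ℝ, IsLadyzhenskayaConstant C_L →
      ∀ g : Fin 2 → ℝ → H, (∀ j, IsForce (g j)) →
        (4 * C_L * grashof ν g ≤ N ∨
          (0 ≤ μ₂ ∧ μ₂ < μ₁ ∧ μ₁ + μ₂ ≤ 1 / 4 * N ^ 2 * ν ∧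
            ∃ g' : Fin 2 → ℝ → H, (∀ j, IsRegularForce (g' j)) ∧
              4 * C_L * Real.sqrt
                (ν / (μ₁ - μ₂) * pairGrashof ν (fun j t => g j t - (μ₁ - μ₂) • g' j t) ^ 2
                  + shiftNumber ν g' ^ 2) ≤ N)) →
        ∀ v : Fin 2 → ℝ → H,
          IsIntertwinedSolution ν (nudgingMatrix μ₁ μ₂) (nudgingFunction N) g v →
          LowModesSynchronize N v → ForcesSynchronize g → Synchronizes v := by
  have hμ := abs_le_of_posSemidef hM
  refine ⟨isFDAssistedSelfSynchronous_nudging hν hμ, ?_⟩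
  rintro C hC g hg (hle | ⟨hμ₂, hμ₁, hμN, g', hg', hle⟩) v hs hlow hforce
  · exact synchronizes_of_grashof_le hν hN hμ hC hg hle hs hlow hforce
  · exact synchronizes_of_shift_le hν hN hμ₂ hμ₁ hμN hC hg hg' hle hs hlow hforce
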